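/- Let $(E,\|\cdot\|)$ be a separable Banach space. Let $\mathcal P_2(E)$ be the set of Borel probability measures $\mu$ on $E$ with $\int\|x\|^2\,d\mu(x)<\infty$, equipped with the Wasserstein distance $$W_2[\mu,\nu]=\Big(\inf_{\pi}\int_{E\times E}\|x-y\|^2\,d\pi(x,y)\Big)^{1/2},$$ where $\pi$ ranges over the probability measures on $E\times E$ with marginals $\mu$ and $\nu$, and with its Borel $\sigma$-algebra. For a random measure $\mu$, that is, a random variable $\mu:\Omega\to\mathcal P_2(E)$ on a probability space $(\Omega,\mathcal F,\mathbb P)$, the intensity $I(\mu)$ is the probability measure on $E$ defined by $\int f\,dI(\mu)=\mathbb E\big[\int f\,d\mu\big]$ for all bounded measurable $f:E\to\mathbb R$. **Proposition.** Let $\mu^N:\Omega\to\mathcal P_2(E)$, $N\ge1$, be a sequence of random measures on $E$ whose intensities $I(\mu^N)$ belong to $\mathcal P_2(E)$, i.e. $\mathbb E\big[\int\|x\|^2\,d\mu^N(x)\big]<\infty$ for every $N$. The following statements are equivalent: (i) the set $\{I(\mu^N): N\ge1\}$ is relatively compact in $\mathcal P_2(E)$; (ii) the family of measures $(I(\mu^N))_N$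 is tight and $$\sup_N\int_{\|x\|>R}\|x\|^2\,dI(\mu^N)(x)\longrightarrow0\quad\text{as }R\to\infty;$$ (iii) every subsequence of $(\mu^N)_N$ has a further subsequence $(\mu^{N'})_{N'}$ for which there exist a probability space $(\widetilde\Omega,\widetilde{\mathcal F},\widetilde{\mathbb P})$ and random variables $\widetilde\mu^{N'},\widetilde\mu:\widetilde\Omega\to\mathcal P_2(E)$ such that $\widetilde\mu^{N'}$ has the same law as $\mu^{N'}$ for every $N'$, and $W_2[\widetilde\mu^{N'},\widetilde\mu]\to0$ as $N'\to\infty$, both $\widetilde{\mathbb P}$-almost surely and in $L^2(\widetilde\Omega)$. -/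

import Mathlib

open MeasureTheory ProbabilityTheory Filter Topology
open scoped ENNReal NNReal

universe u v w

/-- The set `Π(μ, ν)` of couplings of `μ` and `ν`: the probability measures on `E × E` with
first marginal `μ` and second marginal `ν`. -/
def couplings {E : Type*} [MeasurableSpace E] (μ ν : Measure E) : Set (Measure (E × E)) :=
  {π | IsProbabilityMeasure π ∧ π.fst = μ ∧ π.snd = ν}

/-- The quadratic Wasserstein distance
`W₂[μ, ν] = (inf over π ∈ Π(μ, ν) of ∫ ‖x - y‖² dπ(x, y)) ^ (1/2)`, with values in `[0, ∞]`. -/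
noncomputable def wassersteinTwo {E : Type*} [NormedAddCommGroup E] [MeasurableSpace E]
    (μ ν : Measure E) : ℝ≥0∞ :=
  (⨅ π ∈ couplings μ ν, ∫⁻ z, ‖z.1 - z.2‖ₑ ^ 2 ∂π) ^ (1 / 2 : ℝ)

/-- The Wasserstein space `𝒫₂(E)`: probability measures on `E` with finite second moment. -/
@[ext]
structure WassersteinSpace (E : Type*) [NormedAddCommGroup E] [MeasurableSpace E] where
  /-- the underlying measure -/
  toMeasure : Measure E
  isProbabilityMeasure : IsProbabilityMeasure toMeasure
  lintegral_lt_top : ∫⁻ x, ‖x‖ₑ ^ 2 ∂toMeasure < ∞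

namespace WassersteinSpace

instance instIsProbabilityMeasure {E : Type*} [NormedAddCommGroup E] [MeasurableSpace E]
    (μ : WassersteinSpace E) : IsProbabilityMeasure μ.toMeasure :=
  μ.isProbabilityMeasure

section Metric

theorem swap_mem_couplings {E : Type*} [MeasurableSpace E] {μ ν : Measure E} {π : Measure (E × E)} (h : π ∈ couplings μ ν) :
    π.map Prod.swap ∈ couplings ν μ := by
  obtain ⟨h0, h1, h2⟩ := h
  exact ⟨Measure.isProbabilityMeasure_map measurable_swap.aemeasurable,
    by rw [Measure.fst_map_swap, h2], by rw [Measure.snd_map_swap, h1]⟩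

variable {E : Type*} [NormedAddCommGroup E] [MeasurableSpace E]

theorem wassersteinTwo_le {μ ν : Measure E} {π : Measure (E × E)} (h : π ∈ couplings μ ν) :
    wassersteinTwo μ ν ≤ (∫⁻ z, ‖z.1 - z.2‖ₑ ^ 2 ∂π) ^ (1 / 2 : ℝ) :=
  ENNReal.rpow_le_rpow (iInf₂_le π h) (by norm_num)

theorem le_wassersteinTwo {μ ν : Measure E} {c : ℝ≥0∞}
    (h : ∀ π ∈ couplings μ ν, c ≤ (∫⁻ z, ‖z.1 - z.2‖ₑ ^ 2 ∂π) ^ (1 / 2 : ℝ)) :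
    c ≤ wassersteinTwo μ ν := by
  unfold wassersteinTwo
  rw [one_div, ENNReal.le_rpow_inv_iff (by norm_num)]
  refine le_iInf₂ fun π hπ => ?_
  have := h π hπ
  rwa [one_div, ENNReal.le_rpow_inv_iff (by norm_num)] at this

variable [BorelSpace E] [TopologicalSpace.SeparableSpace E]

theorem measurable_cost : Measurable fun z : E × E => ‖z.1 - z.2‖ₑ := by
  have : SecondCountableTopology E := UniformSpace.secondCountable_of_separable E
  fun_prop

theorem wassersteinTwo_self (μ : Measure E) [IsProbabilityMeasure μ] :
    wassersteinTwo μ μ = 0 := by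
  have hm : Measurable fun x : E => (x, x) := by fun_prop
  have hmem : μ.map (fun x : E => (x, x)) ∈ couplings μ μ := by
    refine ⟨Measure.isProbabilityMeasure_map hm.aemeasurable, ?_, ?_⟩
    · rw [Measure.fst, Measure.map_map measurable_fst hm]
      exact Measure.map_id
    · rw [Measure.snd, Measure.map_map measurable_snd hm]
      exact Measure.map_id
  refine le_antisymm ((wassersteinTwo_le hmem).trans ?_) zero_le
  rw [lintegral_map (measurable_cost.pow_const 2) hm]
  simp

theorem wassersteinTwo_comm_le (μ ν : Measure E) :
    wassersteinTwo μ ν ≤ wassersteinTwo ν μ := by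
  refine le_wassersteinTwo fun π hπ => (wassersteinTwo_le (swap_mem_couplings hπ)).trans ?_
  rw [lintegral_map (measurable_cost.pow_const 2) measurable_swap]
  simp [enorm_sub_rev]

theorem cost_ne_top (μ ν : WassersteinSpace E) :
    wassersteinTwo μ.toMeasure ν.toMeasure ≠ ∞ := by
  have : SecondCountableTopology E := UniformSpace.secondCountable_of_separable E
  have hmem : μ.toMeasure.prod ν.toMeasure ∈ couplings μ.toMeasure ν.toMeasure :=
    ⟨inferInstance, by simp, by simp⟩
  refine ((wassersteinTwo_le hmem).trans_lt ?_).ne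
  refine ENNReal.rpow_lt_top_of_nonneg (by norm_num) ?_
  have h1 : ∫⁻ z, ‖z.1‖ₑ ^ 2 ∂(μ.toMeasure.prod ν.toMeasure) < ∞ := by
    have := lintegral_map (μ := μ.toMeasure.prod ν.toMeasure) (f := fun x : E => ‖x‖ₑ ^ 2)
      (by fun_prop) measurable_fst
    rw [← this]
    have h := μ.lintegral_lt_top
    simpa using! h
  have h2 : ∫⁻ z, ‖z.2‖ₑ ^ 2 ∂(μ.toMeasure.prod ν.toMeasure) < ∞ := by
    have := lintegral_map (μ := μ.toMeasure.prod ν.toMeasure) (f := fun x : E => ‖x‖ₑ ^ 2)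
      (by fun_prop) measurable_snd
    rw [← this]
    have h := ν.lintegral_lt_top
    simpa using! h
  refine (lt_of_le_of_lt (lintegral_mono (g := fun z : E × E => 2 * ‖z.1‖ₑ ^ 2 + 2 * ‖z.2‖ₑ ^ 2)
    fun z => ?_) ?_).ne
  · have ha := enorm_sub_le (a := z.1) (b := z.2)
    calc ‖z.1 - z.2‖ₑ ^ 2 ≤ (‖z.1‖ₑ + ‖z.2‖ₑ) ^ 2 := by gcongr
      _ ≤ 2 * (‖z.1‖ₑ ^ 2 + ‖z.2‖ₑ ^ 2) := by
        simp only [enorm_eq_nnnorm]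
        norm_cast
        exact add_sq_le
      _ = _ := by ring
  · rw [lintegral_add_left (by fun_prop), lintegral_const_mul _ (by fun_prop),
      lintegral_const_mul _ (by fun_prop)]
    exact ENNReal.add_lt_top.2 ⟨ENNReal.mul_lt_top (by simp) h1, ENNReal.mul_lt_top (by simp) h2⟩

/-- Integrals of Lipschitz functions are controlled by the Wasserstein distance. -/
theorem lintegral_le_add_wassersteinTwo {L : ℝ≥0} (hL : L ≠ 0) {f : E → ℝ≥0} (hf : LipschitzWith L f)
    (μ ν : Measure E) :
    ∫⁻ x, f x ∂μ ≤ ∫⁻ x, f x ∂ν + L * wassersteinTwo μ ν := by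
  have hfm : Measurable fun x => (f x : ℝ≥0∞) := hf.continuous.measurable.coe_nnreal_ennreal
  have key : ∀ π ∈ couplings μ ν, ∫⁻ x, f x ∂μ ≤
      ∫⁻ x, f x ∂ν + L * (∫⁻ z, ‖z.1 - z.2‖ₑ ^ 2 ∂π) ^ (1 / 2 : ℝ) := by
    rintro π ⟨h0, h1, h2⟩
    have hc : ∫⁻ z, ‖z.1 - z.2‖ₑ ∂π ≤ (∫⁻ z, ‖z.1 - z.2‖ₑ ^ 2 ∂π) ^ (1 / 2 : ℝ) := by
      have : SecondCountableTopology E := UniformSpace.secondCountable_of_separable E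
      have hs : AEStronglyMeasurable (fun z : E × E => z.1 - z.2) π := by
        exact (by fun_prop : Measurable fun z : E × E => z.1 - z.2).aestronglyMeasurable
      have := eLpNorm'_le_eLpNorm'_of_exponent_le (p := 1) (q := 2) one_pos one_le_two π hs
      simpa [eLpNorm'] using this
    calc ∫⁻ x, f x ∂μ = ∫⁻ z, f z.1 ∂π := by
          rw [← h1, Measure.fst, lintegral_map hfm measurable_fst]
      _ ≤ ∫⁻ z, (f z.2 + L * ‖z.1 - z.2‖ₑ) ∂π := by
          refine lintegral_mono fun z => ?_
          have := hf z.1 z.2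
          rw [edist_eq_enorm_sub z.1] at this
          have h3 : (f z.1 : ℝ≥0∞) ≤ f z.2 + edist (f z.1) (f z.2) := by
            rw [edist_nndist]
            norm_cast
            rw [← NNReal.coe_le_coe]
            push_cast
            have := abs_le.1 (le_of_eq (NNReal.dist_eq (f z.1) (f z.2)).symm)
            linarith [this.2]
          exact h3.trans (by gcongr)
      _ = ∫⁻ x, f x ∂ν + L * ∫⁻ z, ‖z.1 - z.2‖ₑ ∂π := by
          have hf2 : Measurable fun z : E × E => (f z.2 : ℝ≥0∞) := hfm.comp measurable_snd
          rw [lintegral_add_left hf2, lintegral_const_mul _ measurable_cost,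
            ← h2, Measure.snd, lintegral_map hfm measurable_snd]
      _ ≤ _ := by gcongr
  rw [← tsub_le_iff_left]
  rw [mul_comm, ← ENNReal.div_le_iff (by simpa using hL) (by simp)]
  refine le_wassersteinTwo fun π hπ => ?_
  rw [ENNReal.div_le_iff (by simpa using hL) (by simp), tsub_le_iff_left, mul_comm]
  exact key π hπ

theorem eq_of_wassersteinTwo_eq_zero {μ ν : WassersteinSpace E}
    (h : wassersteinTwo μ.toMeasure ν.toMeasure = 0) : μ = ν := by
  have h' : wassersteinTwo ν.toMeasure μ.toMeasure = 0 :=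
    le_antisymm ((wassersteinTwo_comm_le _ _).trans h.le) zero_le
  refine WassersteinSpace.ext (ext_of_generate_finite {s | IsClosed s} ?_ isPiSystem_isClosed
    (fun F hF => ?_) (by simp))
  · rw [BorelSpace.measurable_eq (α := E), borel_eq_generateFrom_isClosed]
  have hδ : ∀ n : ℕ, (0 : ℝ) < 1 / ((n : ℝ) + 1) := fun n => by positivity
  refine tendsto_nhds_unique
    (tendsto_lintegral_thickenedIndicator_of_isClosed μ.toMeasure hF hδ
      tendsto_one_div_add_atTop_nhds_zero_nat) ?_
  refine (tendsto_lintegral_thickenedIndicator_of_isClosed ν.toMeasure hF hδ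
      tendsto_one_div_add_atTop_nhds_zero_nat).congr fun n => le_antisymm ?_ ?_
  · simpa [h'] using lintegral_le_add_wassersteinTwo (by simpa using hδ n)
      (lipschitzWith_thickenedIndicator (hδ n) F)
      ν.toMeasure μ.toMeasure
  · simpa [h] using lintegral_le_add_wassersteinTwo (by simpa using hδ n)
      (lipschitzWith_thickenedIndicator (hδ n) F)
      μ.toMeasure ν.toMeasure

variable [CompleteSpace E]

/-- Gluing of two couplings along their common marginal. -/
theorem exists_gluing {μ ν ρ : Measure E} {π₁ π₂ : Measure (E × E)}
    (h₁ : π₁ ∈ couplings μ ν) (h₂ : π₂ ∈ couplings ν ρ) :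
    ∃ γ : Measure ((E × E) × E), γ.map Prod.fst = π₁ ∧ γ.map (fun z => (z.1.2, z.2)) = π₂ := by
  have : SecondCountableTopology E := UniformSpace.secondCountable_of_separable E
  obtain ⟨hp₁, -, hs₁⟩ := h₁
  obtain ⟨hp₂, hf₂, -⟩ := h₂
  let κ : Kernel (E × E) E := π₂.condKernel.comap Prod.snd measurable_snd
  refine ⟨π₁ ⊗ₘ κ, Measure.fst_compProd π₁ κ, ?_⟩
  have hm : Measurable fun z : (E × E) × E => (z.1.2, z.2) := by fun_prop
  refine Measure.ext_of_lintegral _ fun f hf => ?_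
  have hfm : Measurable fun z : (E × E) × E => f (z.1.2, z.2) := hf.comp hm
  rw [lintegral_map hf hm, Measure.lintegral_compProd hfm]
  conv_rhs => rw [← π₂.disintegrate π₂.condKernel, Measure.lintegral_compProd hf, hf₂, ← hs₁,
    Measure.snd, lintegral_map (by fun_prop) measurable_snd]
  rfl

theorem wassersteinTwo_triangle (μ ν ρ : Measure E) :
    wassersteinTwo μ ρ ≤ wassersteinTwo μ ν + wassersteinTwo ν ρ := by
  have key : ∀ π₁ ∈ couplings μ ν, ∀ π₂ ∈ couplings ν ρ, wassersteinTwo μ ρ ≤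
      (∫⁻ z, ‖z.1 - z.2‖ₑ ^ 2 ∂π₁) ^ (1 / 2 : ℝ) + (∫⁻ z, ‖z.1 - z.2‖ₑ ^ 2 ∂π₂) ^ (1 / 2 : ℝ) := by
    intro π₁ h₁ π₂ h₂
    obtain ⟨γ, hγ₁, hγ₂⟩ := exists_gluing h₁ h₂
    have hm₂ : Measurable fun z : (E × E) × E => (z.1.2, z.2) := by fun_prop
    have hm₃ : Measurable fun z : (E × E) × E => (z.1.1, z.2) := by fun_prop
    obtain ⟨hp₁, hf₁, hs₁⟩ := h₁
    obtain ⟨hp₂, hf₂, hs₂⟩ := h₂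
    have hγ : IsProbabilityMeasure γ := by
      rw [← hγ₁] at hp₁
      exact (Measure.isProbabilityMeasure_map_iff measurable_fst.aemeasurable).1 hp₁
    have hmem : γ.map (fun z => (z.1.1, z.2)) ∈ couplings μ ρ := by
      refine ⟨Measure.isProbabilityMeasure_map hm₃.aemeasurable, ?_, ?_⟩
      · rw [← hf₁, ← hγ₁, Measure.fst, Measure.fst, Measure.map_map measurable_fst hm₃,
          Measure.map_map measurable_fst measurable_fst]
        rfl
      · rw [← hs₂, ← hγ₂, Measure.snd, Measure.snd, Measure.map_map measurable_snd hm₃,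
          Measure.map_map measurable_snd hm₂]
        rfl
    refine (wassersteinTwo_le hmem).trans ?_
    rw [← hγ₁, ← hγ₂, lintegral_map (measurable_cost.pow_const 2) hm₃,
      lintegral_map (measurable_cost.pow_const 2) hm₂,
      lintegral_map (measurable_cost.pow_const 2) measurable_fst]
    have hmink := ENNReal.lintegral_Lp_add_le (μ := γ) (p := 2)
      (measurable_cost.comp measurable_fst).aemeasurable
      (measurable_cost.comp hm₂).aemeasurable one_le_two
    simp only [Pi.add_apply, Function.comp_apply, ENNReal.rpow_two] at hmink
    refine le_trans ?_ hmink
    gcongr with z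
    simpa using enorm_add_le (z.1.1 - z.1.2) (z.1.2 - z.2)
  rw [← tsub_le_iff_right]
  refine le_wassersteinTwo fun π₁ h₁ => ?_
  rw [tsub_le_iff_right, ← tsub_le_iff_left]
  refine le_wassersteinTwo fun π₂ h₂ => ?_
  rw [tsub_le_iff_left]
  exact key π₁ h₁ π₂ h₂

end Metric

section Space

variable {E : Type*} [NormedAddCommGroup E] [MeasurableSpace E] [BorelSpace E]
  [TopologicalSpace.SeparableSpace E] [CompleteSpace E]

/-- `𝒫₂(E)` is a metric space for the distance `W₂`. -/
noncomputable instance instMetricSpace : MetricSpace (WassersteinSpace E) where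
  dist μ ν := (wassersteinTwo μ.toMeasure ν.toMeasure).toReal
  dist_self μ := by simp [wassersteinTwo_self]
  dist_comm μ ν := congrArg ENNReal.toReal
    (le_antisymm (wassersteinTwo_comm_le _ _) (wassersteinTwo_comm_le _ _))
  dist_triangle μ ν ρ := by
    rw [← ENNReal.toReal_add (cost_ne_top μ ν) (cost_ne_top ν ρ)]
    exact ENNReal.toReal_mono (ENNReal.add_ne_top.2 ⟨cost_ne_top μ ν, cost_ne_top ν ρ⟩)
      (wassersteinTwo_triangle _ _ _)
  eq_of_dist_eq_zero {μ ν} h := eq_of_wassersteinTwo_eq_zero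
    (((ENNReal.toReal_eq_zero_iff _).1 h).resolve_right (cost_ne_top μ ν))

/-- `𝒫₂(E)` carries the Borel `σ`-algebra of the distance `W₂`. -/
noncomputable instance instMeasurableSpace : MeasurableSpace (WassersteinSpace E) := borel _

instance instBorelSpace : BorelSpace (WassersteinSpace E) := ⟨rfl⟩

theorem continuous_lintegral {L : ℝ≥0} (hL : L ≠ 0) {f : E → ℝ≥0} (hf : LipschitzWith L f) :
    Continuous fun μ : WassersteinSpace E => ∫⁻ x, f x ∂μ.toMeasure := by
  have hed : ∀ μ ν : WassersteinSpace E,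
      edist μ ν = wassersteinTwo μ.toMeasure ν.toMeasure := fun μ ν => by
    rw [edist_dist]
    exact ENNReal.ofReal_toReal (cost_ne_top μ ν)
  refine continuous_of_le_add_edist L (by simp) fun μ ν => ?_
  rw [hed]
  exact lintegral_le_add_wassersteinTwo hL hf _ _

theorem measurable_toMeasure :
    Measurable (toMeasure : WassersteinSpace E → Measure E) := by
  refine Measurable.measure_of_isPiSystem_of_isProbabilityMeasure (S := {s | IsClosed s})
    (by rw [BorelSpace.measurable_eq (α := E), borel_eq_generateFrom_isClosed])
    isPiSystem_isClosed fun F hF => ?_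
  have hδ : ∀ n : ℕ, (0 : ℝ) < 1 / ((n : ℝ) + 1) := fun n => by positivity
  refine measurable_of_tendsto_metrizable (f := fun n (μ : WassersteinSpace E) =>
    ∫⁻ x, (thickenedIndicator (hδ n) F x : ℝ≥0∞) ∂μ.toMeasure) (fun n => ?_)
    (tendsto_pi_nhds.2 fun μ => tendsto_lintegral_thickenedIndicator_of_isClosed μ.toMeasure hF hδ
      tendsto_one_div_add_atTop_nhds_zero_nat)
  exact (continuous_lintegral (by simpa using hδ n)
    (lipschitzWith_thickenedIndicator (hδ n) F)).measurable

end Space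

end WassersteinSpace

/-- The intensity `I(μ)` of a random measure `μ` defined on the probability space `(Ω, P)`: the
measure on `E` with `I(μ)(A) = 𝔼[μ(A)]` for measurable `A`. -/
noncomputable def intensity {Ω E : Type*} [MeasurableSpace Ω] [NormedAddCommGroup E]
    [MeasurableSpace E] (P : Measure Ω) (μ : Ω → WassersteinSpace E) : Measure E :=
  P.bind fun ω => (μ ω).toMeasure

section Intensity

variable {Ω E : Type*} [MeasurableSpace Ω] [NormedAddCommGroup E] [MeasurableSpace E]
  [BorelSpace E] [TopologicalSpace.SeparableSpace E] [CompleteSpace E]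

/-- The defining relation `⟨f, I(μ)⟩ = 𝔼[⟨f, μ⟩]`. -/
theorem lintegral_intensity (P : Measure Ω) {μ : Ω → WassersteinSpace E} (hμ : Measurable μ)
    {f : E → ℝ≥0∞} (hf : Measurable f) :
    ∫⁻ x, f x ∂(intensity P μ) = ∫⁻ ω, ∫⁻ x, f x ∂(μ ω).toMeasure ∂P :=
  Measure.lintegral_bind (WassersteinSpace.measurable_toMeasure.comp hμ).aemeasurable
    hf.aemeasurable

theorem isProbabilityMeasure_intensity (P : Measure Ω) [IsProbabilityMeasure P]
    {μ : Ω → WassersteinSpace E} (hμ : Measurable μ) :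
    IsProbabilityMeasure (intensity P μ) := by
  constructor
  have h := lintegral_intensity P hμ (f := fun _ => 1) measurable_const
  simpa using h

/-- The intensity of a random measure, as a point of `𝒫₂(E)` when its second moment is finite. -/
noncomputable def intensityPoint (P : Measure Ω) [IsProbabilityMeasure P]
    (μ : Ω → WassersteinSpace E) (hμ : Measurable μ)
    (hI : ∫⁻ x, ‖x‖ₑ ^ 2 ∂(intensity P μ) < ∞) : WassersteinSpace E :=
  ⟨intensity P μ, isProbabilityMeasure_intensity P hμ, hI⟩

end Intensity

/-! A set in `𝒫₂(E)` is relatively compact exactly when it is tight and has uniformly integrable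
second moments. Granting this, (ii) implies (iii) by applying the criterion one level up, to the
laws of the `μ N` on `𝒫₂(E)`. By Markov's inequality, tails that are small for the intensity are
small for the random measure with high probability, so the laws are tight
(`isTightMeasureSet_laws`). Uniform integrability lifts as well (`unifSqIntegrable_laws`).
Prokhorov's theorem then gives a weak limit law along a subsequence.

Skorokhod's representation is built from couplings. If `μs n → μ` weakly with uniformly integrable
squared distances, there are couplings of `μ` with `μs n` of arbitrarily small quadratic cost: match
masses block by block on a finite partition into small continuity sets
(`eventually_exists_coupling_cost_le`). Applied on `E`, this turns weak convergence into
`W₂`-convergence. Applied on `𝒫₂(E)` with costs `2⁻ᵏ`, and gluing all couplings along their common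
first marginal, it gives `L²` convergence, and almost sure convergence by summability.

For (iii) implies (i), `L²`-close random measures must be shown to have close intensities. Bounding
`W₂` between intensities directly would require measurably chosen couplings. Instead, measures are
compared one-sidedly through `L²` norms of `1`-Lipschitz functions (`SqNormNear`). This relation is
implied by `W₂`-closeness and passes to intensities by Minkowski's inequality. Tested on `‖x‖ - r`
and on truncated distances to compact sets, finite nets for it still yield tightness and uniform
integrability (`isTight_and_unifSqIntegrable_of_finite_net`), hence compactness. The same argument
gives (i) implies (ii). -/

/-! ### Couplings near the diagonal from weak convergence -/

section Coupling

/-- If `ν` dominates `c • μ` on every block of a finite partition, then `μ` and `ν` admit a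
coupling that gives mass at most `1 - c` to pairs lying in different blocks. -/
theorem exists_coupling_of_partition {S ι : Type*} [MeasurableSpace S] [Fintype ι]
    {μ ν : Measure S} [IsProbabilityMeasure μ] [IsProbabilityMeasure ν] {B : ι → Set S}
    (hB : ∀ i, MeasurableSet (B i)) (hd : Pairwise (Function.onFun Disjoint B))
    (hU : ⋃ i, B i = Set.univ) {c e : ℝ≥0∞} (hce : c + e = 1) (hc : c ≠ 0)
    (h : ∀ i, c * μ (B i) ≤ ν (B i)) :
    ∃ π ∈ couplings μ ν, π (⋃ i, B i ×ˢ B i)ᶜ ≤ e := by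
  have hctop : c ≠ ∞ := fun h' => by simp [h'] at hce
  have hsum : ∀ (m : Measure S) (A : Set S), MeasurableSet A → ∑ i, m (A ∩ B i) = m A := by
    intro m A hA
    have := measure_iUnion (μ := m) (f := fun i => A ∩ B i)
      (fun i j hij => (hd hij).mono Set.inter_subset_right Set.inter_subset_right)
      (fun i => hA.inter (hB i))
    rw [← Set.inter_iUnion, hU, Set.inter_univ, tsum_fintype] at this
    exact this.symm
  have hsum' : ∀ m : Measure S, ∑ i, m (B i) = m Set.univ := by
    intro m
    simpa using hsum m Set.univ MeasurableSet.univ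
  -- `q i` is the fraction of the `ν`-mass of block `i` that gets matched with `c • μ` inside the
  -- block. On a `ν`-null block it is `0 * ∞ = 0`, since `μ` vanishes there too.
  let q : ι → ℝ≥0∞ := fun i => c * μ (B i) * (ν (B i))⁻¹
  have hq : ∀ i, q i ≤ 1 := fun i => by
    simp only [q]
    rw [← div_eq_mul_inv]
    exact ENNReal.div_le_of_le_mul (by simpa using h i)
  have hνμ : ∀ i, ν (B i) = 0 → μ (B i) = 0 := fun i hi => by
    have := h i
    rw [hi, nonpos_iff_eq_zero, mul_eq_zero] at this
    exact this.resolve_left hc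
  have hqν : ∀ i, q i * ν (B i) = c * μ (B i) := fun i => by
    by_cases hi : ν (B i) = 0
    · simp [hi, hνμ i hi]
    · simp only [q]
      rw [mul_assoc, ENNReal.inv_mul_cancel hi (measure_ne_top _ _), mul_one]
  -- The unmatched part of `ν`, of total mass `e`. Pairing it independently with `μ` restores both
  -- marginals and is the only source of mass outside the diagonal blocks.
  let lam : Measure S := ∑ i, (1 - q i) • ν.restrict (B i)
  have hlam : ∀ A, MeasurableSet A → lam A = ∑ i, (1 - q i) * ν (A ∩ B i) := by
    intro A hA
    simp [lam, Measure.restrict_apply hA]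
  have hlamuniv : lam Set.univ = e := by
    have h1 : lam Set.univ + c = 1 := by
      calc lam Set.univ + c = ∑ i, (1 - q i) * ν (B i) + ∑ i, c * μ (B i) := by
            rw [hlam _ MeasurableSet.univ, ← Finset.mul_sum, hsum' μ]
            simp
        _ = ∑ i, ν (B i) := by
            rw [← Finset.sum_add_distrib]
            refine Finset.sum_congr rfl fun i _ => ?_
            rw [← hqν i, ← add_mul, tsub_add_cancel_of_le (hq i), one_mul]
        _ = 1 := by rw [hsum' ν, measure_univ]
    rw [← hce, add_comm c e] at h1
    exact (ENNReal.add_left_inj hctop).1 h1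
  have : IsFiniteMeasure lam := ⟨by
    rw [hlamuniv]; exact lt_of_le_of_lt (by rw [← hce]; exact le_add_self) ENNReal.one_lt_top⟩
  let D : ι → Measure (S × S) := fun i =>
    (c * (ν (B i))⁻¹) • (μ.restrict (B i)).prod (ν.restrict (B i))
  have hD : ∀ i (A A' : Set S), MeasurableSet A → MeasurableSet A' →
      D i (A ×ˢ A') = c * (ν (B i))⁻¹ * (μ (A ∩ B i) * ν (A' ∩ B i)) := by
    intro i A A' hA hA'
    simp [D, Measure.prod_prod, Measure.restrict_apply hA, Measure.restrict_apply hA']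
  let π : Measure (S × S) := ∑ i, D i + μ.prod lam
  have hfst : π.fst = μ := by
    ext A hA
    rw [Measure.fst_apply hA, ← Set.prod_univ]
    simp only [π, Measure.add_apply, Measure.finsetSum_apply, Measure.prod_prod, hlamuniv]
    have : ∀ i, D i (A ×ˢ Set.univ) = c * μ (A ∩ B i) := fun i => by
      rw [hD i _ _ hA MeasurableSet.univ, Set.univ_inter]
      by_cases hi : ν (B i) = 0
      · simp [hi, measure_mono_null Set.inter_subset_right (hνμ i hi)]
      · rw [mul_comm (μ _), mul_assoc, ← mul_assoc _ (ν _), ENNReal.inv_mul_cancel hi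
          (measure_ne_top _ _), one_mul]
    simp_rw [this]
    rw [← Finset.mul_sum, hsum μ A hA, mul_comm (μ A), ← add_mul, hce, one_mul]
  have hsnd : π.snd = ν := by
    ext A hA
    rw [Measure.snd_apply hA, ← Set.univ_prod]
    simp only [π, Measure.add_apply, Measure.finsetSum_apply, Measure.prod_prod, measure_univ,
      one_mul, hlam A hA]
    rw [← Finset.sum_add_distrib, ← hsum ν A hA]
    refine Finset.sum_congr rfl fun i _ => ?_
    rw [hD i _ _ MeasurableSet.univ hA, Set.univ_inter, ← mul_assoc, mul_right_comm c, ← add_mul]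
    change (q i + _) * _ = _
    rw [add_tsub_cancel_of_le (hq i), one_mul]
  refine ⟨π, ⟨⟨by rw [← Measure.fst_univ, hfst, measure_univ]⟩, hfst, hsnd⟩, ?_⟩
  simp only [π, Measure.add_apply, Measure.finsetSum_apply]
  have h0 : ∀ i, D i (⋃ i, B i ×ˢ B i)ᶜ = 0 := fun i => by
    refine measure_mono_null (Set.compl_subset_compl.2 (Set.subset_iUnion _ i)) ?_
    simp only [D, Measure.prod_restrict, Measure.smul_apply, smul_eq_mul]
    rw [Measure.restrict_apply ((hB i).prod (hB i)).compl, Set.compl_inter_self]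
    simp
  simp only [h0, Finset.sum_const_zero, zero_add]
  refine (measure_mono (Set.subset_univ _)).trans ?_
  rw [← Set.univ_prod_univ, Measure.prod_prod, measure_univ, one_mul, hlamuniv]

theorem measure_frontier_diff_eq_zero {S : Type*} [TopologicalSpace S] [MeasurableSpace S]
    {μ : Measure S} {s t : Set S} (hs : μ (frontier s) = 0) (ht : μ (frontier t) = 0) :
    μ (frontier (s \ t)) = 0 := by
  refine measure_mono_null ?_ (measure_union_null hs ht)
  rw [Set.sdiff_eq]
  refine (frontier_inter_subset s tᶜ).trans (Set.union_subset_union Set.inter_subset_left ?_)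
  rw [frontier_compl]
  exact Set.inter_subset_right

variable {S : Type*} [PseudoMetricSpace S] [TopologicalSpace.SeparableSpace S] [MeasurableSpace S]
  [BorelSpace S]

/-- A finite measurable partition into continuity sets, all of small diameter except the last one,
which has small measure. -/
theorem exists_partition_null_frontier (μ : Measure S) [IsProbabilityMeasure μ] {ε : ℝ}
    (hε : 0 < ε) :
    ∃ (k : ℕ) (B : Fin (k + 1) → Set S), (∀ i, MeasurableSet (B i)) ∧
      (∀ i, μ (frontier (B i)) = 0) ∧ Pairwise (Function.onFun Disjoint B) ∧
      ⋃ i, B i = Set.univ ∧ μ (B (Fin.last k)) ≤ ENNReal.ofReal ε ∧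
      ∀ i, i ≠ Fin.last k → ∀ x ∈ B i, ∀ y ∈ B i, dist x y ≤ ε := by
  have : Nonempty S := nonempty_of_isProbabilityMeasure μ
  let s := TopologicalSpace.denseSeq S
  choose r hr hr0 using fun n => exists_null_frontier_thickening μ {s n}
    (show ε / 4 < ε / 2 by linarith)
  simp only [Metric.thickening_singleton] at hr0
  have hcov : ⋃ n, Metric.ball (s n) (r n) = Set.univ := by
    refine Set.eq_univ_of_forall fun x => ?_
    obtain ⟨n, hn⟩ := (TopologicalSpace.denseRange_denseSeq S).exists_dist_lt x
      (show 0 < ε / 4 by linarith)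
    exact Set.mem_iUnion.2 ⟨n, Metric.mem_ball.2 (hn.trans (hr n).1)⟩
  obtain ⟨k, hk⟩ : ∃ k, μ (⋃ n, ⋃ (_ : n < k), Metric.ball (s n) (r n))ᶜ ≤ ENNReal.ofReal ε := by
    have hanti : Antitone fun k => (⋃ n, ⋃ (_ : n < k), Metric.ball (s n) (r n))ᶜ :=
      fun a b hab => Set.compl_subset_compl.2
        (Set.iUnion₂_mono' fun n hn => ⟨n, hn.trans_le hab, le_rfl⟩)
    have ht := tendsto_measure_iInter_atTop (μ := μ) (fun k => ((MeasurableSet.iUnion fun n =>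
      MeasurableSet.iUnion fun (_ : n < k) =>
        (Metric.isOpen_ball (x := s n) (ε := r n)).measurableSet).compl).nullMeasurableSet)
      hanti ⟨0, measure_ne_top _ _⟩
    have hemp : ⋂ k, (⋃ n, ⋃ (_ : n < k), Metric.ball (s n) (r n))ᶜ = ∅ := by
      rw [← Set.compl_iUnion, Set.compl_empty_iff]
      refine Set.eq_univ_of_forall fun x => ?_
      obtain ⟨n, hn⟩ := Set.mem_iUnion.1 (hcov ▸ Set.mem_univ x)
      exact Set.mem_iUnion.2 ⟨n + 1, Set.mem_iUnion₂.2 ⟨n, n.lt_succ_self, hn⟩⟩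
    rw [hemp, measure_empty] at ht
    obtain ⟨k, hk⟩ := (ht.eventually (ge_mem_nhds (ENNReal.ofReal_pos.2 hε))).exists
    exact ⟨k, hk⟩
  -- With the whole space as last set, disjointing leaves there exactly what the `k` balls miss. The
  -- balls have radius below `ε / 2`, hence the diameter bound.
  let f : Fin (k + 1) → Set S := fun i => if i = Fin.last k then Set.univ else
    Metric.ball (s i) (r i)
  have hfm : ∀ i, MeasurableSet (f i) := fun i => by
    simp only [f]
    split_ifs
    · exact MeasurableSet.univ
    · exact Metric.isOpen_ball.measurableSet
  have hff : ∀ i, μ (frontier (f i)) = 0 := fun i => by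
    simp only [f]
    split_ifs
    · simp
    · exact hr0 _
  refine ⟨k, disjointed f, fun i => disjointedRec (fun t j ht => ht.diff (hfm j)) (hfm i),
    fun i => disjointedRec (p := fun t => μ (frontier t) = 0)
      (fun t j ht => measure_frontier_diff_eq_zero ht (hff j)) (hff i),
    disjoint_disjointed f, ?_, ?_, ?_⟩
  · rw [iUnion_disjointed]
    exact Set.eq_univ_of_forall fun x => Set.mem_iUnion.2 ⟨Fin.last k, by simp [f]⟩
  · refine (measure_mono ?_).trans hk
    intro x hx hx'
    obtain ⟨n, hn, hxn⟩ := Set.mem_iUnion₂.1 hx'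
    let j : Fin (k + 1) := ⟨n, by omega⟩
    have hj : j < Fin.last k := hn
    rw [disjointed_apply] at hx
    refine hx.2 ?_
    simp only [Finset.sup_set_eq_biUnion, Set.mem_iUnion]
    refine ⟨j, Finset.mem_Iio.2 hj, ?_⟩
    simp only [f, if_neg hj.ne]
    exact hxn
  · intro i hi x hx y hy
    have hx' := disjointed_subset f i hx
    have hy' := disjointed_subset f i hy
    simp only [f, if_neg hi, Metric.mem_ball] at hx' hy'
    have := dist_triangle_right x y (s i)
    linarith [(hr i).2]

/-- Weak convergence is realised by couplings that concentrate near the diagonal. -/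
theorem eventually_exists_coupling_of_tendsto {μ : ProbabilityMeasure S}
    {μs : ℕ → ProbabilityMeasure S} (h : Tendsto μs atTop (𝓝 μ)) {ε : ℝ} (hε : 0 < ε) :
    ∀ᶠ n in atTop, ∃ π ∈ couplings (μ : Measure S) (μs n),
      π {z | ε < dist z.1 z.2} ≤ ENNReal.ofReal ε := by
  -- `δ` is spent twice, on unmatched mass and on the last block, so `2 * δ ≤ ε` is needed. The
  -- bound `1 / 2` keeps `1 - δ` positive.
  set δ := min (ε / 2) (1 / 2) with hδ
  have hδ0 : 0 < δ := by positivity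
  have hδ1 : δ ≤ 1 / 2 := min_le_right _ _
  have hδε : δ ≤ ε / 2 := min_le_left _ _
  obtain ⟨k, B, hBm, hBf, hd, hU, hlast, hdiam⟩ :=
    exists_partition_null_frontier (μ : Measure S) hδ0
  have hc0 : ENNReal.ofReal (1 - δ) ≠ 0 := by
    simpa using (by linarith : δ < 1)
  -- On a continuity set of positive mass, `μs n (B i)` tends to `μ (B i)`, which strictly exceeds
  -- `(1 - δ) * μ (B i)`.
  have hev : ∀ i, ∀ᶠ n in atTop,
      ENNReal.ofReal (1 - δ) * (μ : Measure S) (B i) ≤ (μs n : Measure S) (B i) := by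
    intro i
    by_cases hi : (μ : Measure S) (B i) = 0
    · simp [hi]
    · refine (ProbabilityMeasure.tendsto_measure_of_null_frontier_of_tendsto' h
        (hBf i)).eventually (le_mem_nhds ?_)
      calc ENNReal.ofReal (1 - δ) * (μ : Measure S) (B i) < 1 * (μ : Measure S) (B i) := by
            refine (ENNReal.mul_lt_mul_iff_left hi (measure_ne_top _ _)).2 ?_
            rw [← ENNReal.ofReal_one]
            exact ENNReal.ofReal_lt_ofReal_iff'.2 ⟨by linarith, one_pos⟩
        _ = _ := one_mul _
  filter_upwards [eventually_all.2 hev] with n hn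
  obtain ⟨π, hπ, hπe⟩ := exists_coupling_of_partition hBm hd hU (e := ENNReal.ofReal δ)
    (by rw [← ENNReal.ofReal_add (by linarith) hδ0.le]; simp) hc0 hn
  refine ⟨π, hπ, ?_⟩
  have hsub : {z : S × S | ε < dist z.1 z.2} ⊆
      (⋃ i, B i ×ˢ B i)ᶜ ∪ Prod.fst ⁻¹' B (Fin.last k) := by
    intro z hz
    by_contra hcon
    simp only [Set.mem_union, not_or, Set.mem_compl_iff, not_not, Set.mem_iUnion,
      Set.mem_preimage] at hcon
    obtain ⟨⟨i, hi⟩, hl⟩ := hcon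
    have hne : i ≠ Fin.last k := fun h' => hl (h' ▸ hi.1)
    have h1 := hdiam i hne _ hi.1 _ hi.2
    have h2 : ε < dist z.1 z.2 := hz
    linarith
  calc π {z | ε < dist z.1 z.2} ≤ π (⋃ i, B i ×ˢ B i)ᶜ + π (Prod.fst ⁻¹' B (Fin.last k)) :=
        (measure_mono hsub).trans (measure_union_le _ _)
    _ ≤ ENNReal.ofReal δ + ENNReal.ofReal δ := by
        gcongr
        rw [← Measure.fst_apply (hBm _), hπ.2.1]
        exact hlast
    _ = ENNReal.ofReal (δ + δ) := (ENNReal.ofReal_add hδ0.le hδ0.le).symm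
    _ ≤ ENNReal.ofReal ε := ENNReal.ofReal_le_ofReal (by linarith)

end Coupling

/-! ### Uniform integrability and quadratic transport cost -/

section UniformIntegrability

/-- A set of measures has uniformly integrable squared distances to `x₀`. -/
def UnifSqIntegrable {S : Type*} [PseudoMetricSpace S] [MeasurableSpace S] (x₀ : S)
    (A : Set (Measure S)) : Prop :=
  ∀ δ : ℝ≥0∞, δ ≠ 0 → ∃ R : ℝ≥0, ∀ ν ∈ A,
    ∫⁻ x in {x | (R : ℝ≥0∞) < edist x x₀}, edist x x₀ ^ 2 ∂ν ≤ δ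

theorem UnifSqIntegrable.mono {S : Type*} [PseudoMetricSpace S] [MeasurableSpace S] {x₀ : S}
    {A B : Set (Measure S)} (hB : UnifSqIntegrable x₀ B) (h : A ⊆ B) : UnifSqIntegrable x₀ A :=
  fun δ hδ => (hB δ hδ).imp fun _ hR ν hν => hR ν (h hν)

theorem lintegral_sq_edist_tail_anti {S : Type*} [PseudoMetricSpace S] [MeasurableSpace S]
    (ν : Measure S) (x₀ : S) {R R' : ℝ≥0} (h : R ≤ R') :
    ∫⁻ x in {x | (R' : ℝ≥0∞) < edist x x₀}, edist x x₀ ^ 2 ∂ν ≤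
      ∫⁻ x in {x | (R : ℝ≥0∞) < edist x x₀}, edist x x₀ ^ 2 ∂ν :=
  lintegral_mono_set fun _ hx => (ENNReal.coe_le_coe.2 h).trans_lt hx

variable {S : Type*} [PseudoMetricSpace S] [MeasurableSpace S] [BorelSpace S]

theorem measurableSet_lt_edist (x₀ : S) (R : ℝ≥0) :
    MeasurableSet {x : S | (R : ℝ≥0∞) < edist x x₀} :=
  (isOpen_lt continuous_const (by fun_prop)).measurableSet

/-- Uniform bounds on the tails pass to weak limits. -/
theorem lintegral_sq_edist_tail_le_of_tendsto {μ : ProbabilityMeasure S}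
    {μs : ℕ → ProbabilityMeasure S} (h : Tendsto μs atTop (𝓝 μ)) (x₀ : S) {R : ℝ≥0} {δ : ℝ≥0∞}
    (hR : ∀ n, ∫⁻ x in {x | (R : ℝ≥0∞) < edist x x₀}, edist x x₀ ^ 2 ∂(μs n : Measure S) ≤ δ) :
    ∫⁻ x in {x | ((2 * R : ℝ≥0) : ℝ≥0∞) < edist x x₀}, edist x x₀ ^ 2 ∂(μ : Measure S) ≤
      4 * δ := by
  -- A continuous function between the two tails: it dominates the squared distance beyond `2 * R`,
  -- where `dist ≤ 2 * (dist - R)`, and is at most four times the squared distance beyond `R` and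
  -- zero elsewhere.
  let f : S → ℝ := fun x => 4 * (max (dist x x₀ - R) 0) ^ 2
  have hf : Continuous f := by fun_prop
  have hf0 : 0 ≤ f := fun x => by simp only [f]; positivity
  have hlow := lintegral_le_liminf_lintegral_of_forall_isOpen_measure_le_liminf_measure
    (μ := (μ : Measure S)) (μs := fun n => (μs n : Measure S)) hf hf0
    (fun G hG => ProbabilityMeasure.le_liminf_measure_open_of_tendsto h hG)
  have hed : ∀ x, edist x x₀ ^ 2 = ENNReal.ofReal (dist x x₀ ^ 2) := fun x => by
    rw [edist_dist, ENNReal.ofReal_pow dist_nonneg]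
  have hlt : ∀ (r : ℝ≥0) x, (r : ℝ≥0∞) < edist x x₀ ↔ (r : ℝ) < dist x x₀ := fun r x => by
    rw [edist_nndist, ENNReal.coe_lt_coe, ← NNReal.coe_lt_coe, coe_nndist]
  calc ∫⁻ x in {x | ((2 * R : ℝ≥0) : ℝ≥0∞) < edist x x₀}, edist x x₀ ^ 2 ∂(μ : Measure S)
      ≤ ∫⁻ x, ENNReal.ofReal (f x) ∂(μ : Measure S) := by
        rw [← lintegral_indicator (measurableSet_lt_edist x₀ _)]
        refine lintegral_mono fun x => ?_
        refine Set.indicator_le' (g := fun x => ENNReal.ofReal (f x)) (fun x hx => ?_)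
          (fun _ _ => zero_le) x
        rw [hed]
        refine ENNReal.ofReal_le_ofReal ?_
        have hx' := (hlt _ _).1 hx
        push_cast at hx'
        have hR0 : (0 : ℝ) ≤ R := R.2
        simp only [f]
        rw [max_eq_left (by linarith)]
        nlinarith
    _ ≤ atTop.liminf fun n => ∫⁻ x, ENNReal.ofReal (f x) ∂(μs n : Measure S) := hlow
    _ ≤ 4 * δ := by
        refine (liminf_le_liminf (Eventually.of_forall fun n => ?_)).trans (liminf_const _).le
        calc ∫⁻ x, ENNReal.ofReal (f x) ∂(μs n : Measure S)
            ≤ ∫⁻ x, 4 * {x | (R : ℝ≥0∞) < edist x x₀}.indicator (fun x => edist x x₀ ^ 2) x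
                ∂(μs n : Measure S) := by
              refine lintegral_mono fun x => ?_
              by_cases hx : (R : ℝ≥0∞) < edist x x₀
              · rw [Set.indicator_of_mem (show x ∈ {x | (R : ℝ≥0∞) < edist x x₀} from hx), hed,
                  show (4 : ℝ≥0∞) = ENNReal.ofReal 4 by simp, ← ENNReal.ofReal_mul (by norm_num)]
                refine ENNReal.ofReal_le_ofReal ?_
                have hx' := (hlt _ _).1 hx
                have hR0 : (0 : ℝ) ≤ R := R.2
                simp only [f]
                rw [max_eq_left (by linarith)]
                nlinarith
              · have hx' := mt (hlt _ _).2 hx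
                simp only [f]
                rw [max_eq_right (by linarith)]
                simp
          _ ≤ 4 * δ := by
              rw [lintegral_const_mul' _ _ (by simp),
                lintegral_indicator (measurableSet_lt_edist x₀ _)]
              gcongr
              exact hR n

variable [TopologicalSpace.SeparableSpace S]

/-- The quadratic cost of a coupling that concentrates near the diagonal. -/
theorem lintegral_sq_edist_le_of_coupling {μ ν : Measure S} {π : Measure (S × S)}
    (hπ : π ∈ couplings μ ν) (x₀ : S) {ε R : ℝ≥0} {η δ : ℝ≥0∞}
    (hη : π {z | (ε : ℝ) < dist z.1 z.2} ≤ η)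
    (hμ : ∫⁻ x in {x | (R : ℝ≥0∞) < edist x x₀}, edist x x₀ ^ 2 ∂μ ≤ δ)
    (hν : ∫⁻ x in {x | (R : ℝ≥0∞) < edist x x₀}, edist x x₀ ^ 2 ∂ν ≤ δ) :
    ∫⁻ z, edist z.1 z.2 ^ 2 ∂π ≤ ε ^ 2 + 4 * R ^ 2 * η + 4 * δ := by
  have : SecondCountableTopology S := UniformSpace.secondCountable_of_separable S
  obtain ⟨hp, h1, h2⟩ := hπ
  set T : S → ℝ≥0∞ := {x | (R : ℝ≥0∞) < edist x x₀}.indicator fun x => edist x x₀ ^ 2 with hT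
  have hTm : Measurable T := by
    refine Measurable.indicator ?_ (measurableSet_lt_edist x₀ R)
    fun_prop
  set D : Set (S × S) := {z | (ε : ℝ) < dist z.1 z.2} with hD
  have hDm : MeasurableSet D := (isOpen_lt continuous_const (by fun_prop)).measurableSet
  have hTle : ∀ x, edist x x₀ ^ 2 ≤ R ^ 2 + T x := fun x => by
    by_cases hx : (R : ℝ≥0∞) < edist x x₀
    · rw [hT, Set.indicator_of_mem (show x ∈ {x | (R : ℝ≥0∞) < edist x x₀} from hx)]
      exact le_add_self
    · exact le_add_right (by gcongr; exact not_lt.1 hx)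
  -- Near the diagonal `ε ^ 2` suffices. On `D` the distance is routed through `x₀`, each leg
  -- costing at most `R ^ 2` plus its tail.
  have hpt : ∀ z : S × S, edist z.1 z.2 ^ 2 ≤
      ε ^ 2 + D.indicator (fun _ => 4 * (R : ℝ≥0∞) ^ 2) z + 2 * T z.1 + 2 * T z.2 := by
    intro z
    by_cases hz : z ∈ D
    · rw [Set.indicator_of_mem hz]
      calc edist z.1 z.2 ^ 2 ≤ (edist z.1 x₀ + edist z.2 x₀) ^ 2 := by
            gcongr
            exact edist_triangle_right _ _ _
        _ ≤ 2 * (edist z.1 x₀ ^ 2 + edist z.2 x₀ ^ 2) := by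
            simp only [edist_nndist]
            norm_cast
            exact add_sq_le
        _ ≤ 2 * ((R ^ 2 + T z.1) + (R ^ 2 + T z.2)) := by
            gcongr <;> exact hTle _
        _ = 4 * (R : ℝ≥0∞) ^ 2 + 2 * T z.1 + 2 * T z.2 := by ring
        _ ≤ _ := by
            rw [add_assoc, add_assoc, add_assoc, ← add_assoc _ (2 * T z.1)]
            exact le_trans (by rw [add_assoc]) le_add_self
    · have : edist z.1 z.2 ≤ ε := by
        rw [edist_nndist, ENNReal.coe_le_coe, ← NNReal.coe_le_coe, coe_nndist]
        exact not_lt.1 hz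
      rw [add_assoc, add_assoc]
      exact le_add_right (by gcongr)
  have hT1 : ∫⁻ z, T z.1 ∂π ≤ δ := by
    rw [← lintegral_map hTm measurable_fst, ← Measure.fst, h1, hT,
      lintegral_indicator (measurableSet_lt_edist x₀ R)]
    exact hμ
  have hT2 : ∫⁻ z, T z.2 ∂π ≤ δ := by
    rw [← lintegral_map hTm measurable_snd, ← Measure.snd, h2, hT,
      lintegral_indicator (measurableSet_lt_edist x₀ R)]
    exact hν
  have hT1m : Measurable fun z : S × S => 2 * T z.1 := (hTm.comp measurable_fst).const_mul 2
  have hT2m : Measurable fun z : S × S => 2 * T z.2 := (hTm.comp measurable_snd).const_mul 2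
  calc ∫⁻ z, edist z.1 z.2 ^ 2 ∂π
      ≤ ∫⁻ z, ε ^ 2 + D.indicator (fun _ => 4 * (R : ℝ≥0∞) ^ 2) z + 2 * T z.1 + 2 * T z.2 ∂π :=
        lintegral_mono hpt
    _ = ε ^ 2 + 4 * R ^ 2 * π D + 2 * ∫⁻ z, T z.1 ∂π + 2 * ∫⁻ z, T z.2 ∂π := by
        rw [lintegral_add_right _ hT2m, lintegral_add_right _ hT1m,
          lintegral_add_left measurable_const, lintegral_const_mul' _ _ (by simp),
          lintegral_const_mul' _ _ (by simp), lintegral_indicator_const hDm, lintegral_const,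
          measure_univ, mul_one]
    _ ≤ ε ^ 2 + 4 * R ^ 2 * η + 2 * δ + 2 * δ := by gcongr
    _ = _ := by ring

/-- Weak convergence together with uniform integrability of the squared distances is realised by
couplings of small quadratic cost. -/
theorem eventually_exists_coupling_cost_le {μ : ProbabilityMeasure S}
    {μs : ℕ → ProbabilityMeasure S} (h : Tendsto μs atTop (𝓝 μ)) {x₀ : S}
    (hU : UnifSqIntegrable x₀ (Set.range fun n => (μs n : Measure S))) {ε : ℝ≥0∞} (hε : ε ≠ 0) :
    ∀ᶠ n in atTop, ∃ π ∈ couplings (μ : Measure S) (μs n),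
      ∫⁻ z, edist z.1 z.2 ^ 2 ∂π ≤ ε := by
  wlog hεt : ε ≠ ∞ generalizing ε
  · filter_upwards [this one_ne_zero ENNReal.one_ne_top] with n ⟨π, hπ, _⟩
    refine ⟨π, hπ, ?_⟩
    rw [not_not.1 hεt]
    exact le_top
  have hε2 : ε / 2 ≠ 0 := by simpa using hε
  -- One factor 4 is lost when the tail bound passes to the weak limit, doubling the radius, and
  -- another in the cost estimate. The other half of `ε` pays for the terms in `t`.
  obtain ⟨R, hR⟩ := hU (ε / 2 / 16) (by simp [hε])
  have htail : ∀ n, ∫⁻ x in {x | (R : ℝ≥0∞) < edist x x₀}, edist x x₀ ^ 2 ∂(μs n : Measure S) ≤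
      ε / 2 / 16 := fun n => hR _ ⟨n, rfl⟩
  have hlim := lintegral_sq_edist_tail_le_of_tendsto h x₀ htail
  have hcont : Tendsto (fun t : ℝ≥0 => ((t : ℝ≥0∞) ^ 2 + 4 * ((2 * R : ℝ≥0) : ℝ≥0∞) ^ 2 * t))
      (𝓝[>] 0) (𝓝 0) := by
    have : Continuous fun t : ℝ≥0 => ((t ^ 2 + 4 * (2 * R) ^ 2 * t : ℝ≥0) : ℝ≥0∞) := by fun_prop
    have h0 := (this.tendsto 0).mono_left (nhdsWithin_le_nhds (s := Set.Ioi 0))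
    simpa using h0
  obtain ⟨t, ht, ht0⟩ := ((hcont.eventually (ge_mem_nhds (pos_iff_ne_zero.2 hε2))).and
    self_mem_nhdsWithin).exists
  filter_upwards [eventually_exists_coupling_of_tendsto h (show (0 : ℝ) < t from ht0)]
    with n ⟨π, hπ, hπt⟩
  refine ⟨π, hπ, ?_⟩
  have := lintegral_sq_edist_le_of_coupling hπ x₀ (ε := t) (R := 2 * R) (δ := 4 * (ε / 2 / 16))
    hπt hlim (((lintegral_sq_edist_tail_anti _ x₀ (by
      rw [two_mul]; exact le_self_add)).trans (htail n)).trans (le_mul_of_one_le_left zero_le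
        (by norm_num)))
  refine this.trans ?_
  have h16 : 4 * (4 * (ε / 2 / 16)) = ε / 2 := by
    rw [← mul_assoc, show (4 * 4 : ℝ≥0∞) = 16 by norm_num, ENNReal.mul_div_cancel (by simp)
      (by simp)]
  rw [h16, ENNReal.ofReal_coe_nnreal]
  calc _ ≤ ε / 2 + ε / 2 := by gcongr
    _ = ε := ENNReal.add_halves ε

end UniformIntegrability

/-! ### Criteria for relative compactness and tightness -/

/-- A sequence in the closure is shadowed by one in `A` at distance below `1 / (n + 1)`, and the two
share limits along subsequences. -/
theorem isCompact_closure_of_subseq {X : Type*} [PseudoMetricSpace X] {A : Set X}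
    (h : ∀ u : ℕ → X, (∀ n, u n ∈ A) →
      ∃ (a : X) (φ : ℕ → ℕ), StrictMono φ ∧ Tendsto (u ∘ φ) atTop (𝓝 a)) :
    IsCompact (closure A) := by
  rw [isCompact_iff_isSeqCompact]
  intro x hx
  choose y hyA hxy using fun n => Metric.mem_closure_iff.1 (hx n) (1 / ((n : ℝ) + 1)) (by positivity)
  obtain ⟨a, φ, hφ, ha⟩ := h y hyA
  have hdist : Tendsto (fun n => dist (x (φ n)) (y (φ n))) atTop (𝓝 0) :=
    squeeze_zero (fun _ => dist_nonneg) (fun n => (hxy (φ n)).le)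
      (tendsto_one_div_add_atTop_nhds_zero_nat.comp hφ.tendsto_atTop)
  have hxa : Tendsto (x ∘ φ) atTop (𝓝 a) := (tendsto_iff_of_dist hdist).2 ha
  exact ⟨a, isClosed_closure.mem_of_tendsto hxa (Eventually.of_forall fun n => hx _), φ, hφ, hxa⟩

/-- In a complete space, tightness follows if for every `δ` most of the mass lies uniformly in the
`δ`-thickening of some compact set. -/
theorem isTightMeasureSet_of_cthickening {X : Type*} [PseudoMetricSpace X] [CompleteSpace X]
    [MeasurableSpace X] {A : Set (Measure X)}
    (h : ∀ δ : ℝ, 0 < δ → ∀ η : ℝ≥0∞, η ≠ 0 → ∃ K : Set X, IsCompact K ∧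
      ∀ ν ∈ A, ν (Metric.cthickening δ K)ᶜ ≤ η) : IsTightMeasureSet A := by
  rw [isTightMeasureSet_iff_exists_isCompact_measure_compl_le]
  intro ε hε
  obtain ⟨η, hη0, hη⟩ := ENNReal.exists_pos_sum_of_countable' hε.ne' ℕ
  choose K hKc hK using fun n : ℕ => h (1 / ((n : ℝ) + 1)) (by positivity) (η n) (hη0 n).ne'
  -- This intersection is closed and totally bounded: a finite net of `K n` is a net for it at a
  -- slightly larger scale. The escaping masses `η n` are summable.
  refine ⟨⋂ n : ℕ, Metric.cthickening (1 / ((n : ℝ) + 1)) (K n), ?_, fun ν hν => ?_⟩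
  · refine TotallyBounded.isCompact_of_isClosed ?_
      (isClosed_iInter fun n => Metric.isClosed_cthickening)
    rw [Metric.totallyBounded_iff]
    intro e he
    obtain ⟨n, hn⟩ := exists_nat_one_div_lt (show 0 < e / 2 by linarith)
    obtain ⟨t, -, ht, hKt⟩ := (hKc n).finite_cover_balls (show 0 < e / 2 by linarith)
    refine ⟨t, ht, fun x hx => ?_⟩
    have hx' := Metric.cthickening_subset_thickening' (by linarith) hn (K n) (Set.mem_iInter.1 hx n)
    obtain ⟨z, hz, hxz⟩ := Metric.mem_thickening_iff.1 hx'
    obtain ⟨y, hy, hzy⟩ := Set.mem_iUnion₂.1 (hKt hz)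
    refine Set.mem_iUnion₂.2 ⟨y, hy, ?_⟩
    rw [Metric.mem_ball] at hzy ⊢
    linarith [dist_triangle x z y]
  · rw [Set.compl_iInter]
    calc ν (⋃ n : ℕ, (Metric.cthickening (1 / ((n : ℝ) + 1)) (K n))ᶜ)
        ≤ ∑' n : ℕ, ν (Metric.cthickening (1 / ((n : ℝ) + 1)) (K n))ᶜ := measure_iUnion_le _
      _ ≤ ∑' n, η n := ENNReal.tsum_le_tsum fun n => hK n ν hν
      _ ≤ ε := hη.le

/-! ### Comparing measures through `L²` norms of Lipschitz functions -/

section SqNorm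

/-- The `L²(ν)` norm of a nonnegative function. -/
noncomputable def sqNorm {E : Type*} [MeasurableSpace E] (ν : Measure E) (g : E → ℝ≥0) : ℝ≥0∞ :=
  (∫⁻ x, (g x : ℝ≥0∞) ^ 2 ∂ν) ^ (1 / 2 : ℝ)

theorem ENNReal.sq_rpow_half (a : ℝ≥0∞) : (a ^ (1 / 2 : ℝ)) ^ 2 = a := by
  rw [← ENNReal.rpow_two, ← ENNReal.rpow_mul]
  norm_num

theorem ENNReal.rpow_half_sq (a : ℝ≥0∞) : (a ^ 2) ^ (1 / 2 : ℝ) = a := by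
  rw [← ENNReal.rpow_two, ← ENNReal.rpow_mul]
  norm_num

theorem ENNReal.rpow_half_le_iff {a b : ℝ≥0∞} : a ^ (1 / 2 : ℝ) ≤ b ↔ a ≤ b ^ 2 := by
  rw [one_div, ENNReal.rpow_inv_le_iff (by norm_num), ENNReal.rpow_two]

theorem sqNorm_sq {E : Type*} [MeasurableSpace E] (ν : Measure E) (g : E → ℝ≥0) :
    sqNorm ν g ^ 2 = ∫⁻ x, (g x : ℝ≥0∞) ^ 2 ∂ν :=
  ENNReal.sq_rpow_half _

/-- `L²` norms of `1`-Lipschitz functions under `ν` exceed those under `ρ` by at most `ε`. -/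
def SqNormNear {E : Type*} [PseudoEMetricSpace E] [MeasurableSpace E] (ε : ℝ≥0∞)
    (ν ρ : Measure E) : Prop :=
  ∀ g : E → ℝ≥0, LipschitzWith 1 g → sqNorm ν g ≤ sqNorm ρ g + ε

theorem SqNormNear.mono {E : Type*} [PseudoEMetricSpace E] [MeasurableSpace E] {ε ε' : ℝ≥0∞}
    {ν ρ : Measure E} (h : SqNormNear ε ν ρ) (hε : ε ≤ ε') : SqNormNear ε' ν ρ :=
  fun g hg => (h g hg).trans (by gcongr)

theorem LipschitzWith.coe_le_add_enorm {E : Type*} [NormedAddCommGroup E] {g : E → ℝ≥0} (hg : LipschitzWith 1 g)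
    (x y : E) :
    (g x : ℝ≥0∞) ≤ g y + ‖x - y‖ₑ := by
  have h := hg x y
  rw [edist_eq_enorm_sub x, ENNReal.coe_one, one_mul] at h
  have h3 : (g x : ℝ≥0∞) ≤ g y + edist (g x) (g y) := by
    rw [edist_nndist]
    norm_cast
    rw [← NNReal.coe_le_coe]
    push_cast
    have := abs_le.1 (le_of_eq (NNReal.dist_eq (g x) (g y)).symm)
    linarith [this.2]
  exact h3.trans (by gcongr)

theorem lipschitzWith_nnnorm_sub {E : Type*} [NormedAddCommGroup E] (r : ℝ≥0) :
    LipschitzWith 1 fun x : E => ‖x‖₊ - r := by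
  refine LipschitzWith.of_dist_le_mul fun x y => ?_
  rw [NNReal.dist_eq, NNReal.coe_one, one_mul, NNReal.coe_sub_def, NNReal.coe_sub_def]
  refine (abs_max_sub_max_le_abs _ _ _).trans ?_
  simp only [coe_nnnorm, sub_sub_sub_cancel_right]
  rw [dist_eq_norm]
  exact abs_norm_sub_norm_le x y

variable {E : Type*} [NormedAddCommGroup E] [MeasurableSpace E] [BorelSpace E]

theorem WassersteinSpace.tendsto_lintegral_tail (ρ : WassersteinSpace E) :
    Tendsto (fun n : ℕ => sqNorm ρ.toMeasure fun x => ‖x‖₊ - (n : ℝ≥0)) atTop (𝓝 0) := by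
  have h : Tendsto (fun n : ℕ => ∫⁻ x, ((‖x‖₊ - (n : ℝ≥0) : ℝ≥0) : ℝ≥0∞) ^ 2 ∂ρ.toMeasure)
      atTop (𝓝 (∫⁻ _, 0 ∂ρ.toMeasure)) := by
    refine tendsto_lintegral_of_dominated_convergence (fun x => ‖x‖ₑ ^ 2) (fun n => by fun_prop)
      (fun n => Eventually.of_forall fun x => ?_) ρ.lintegral_lt_top.ne
      (Eventually.of_forall fun x => ?_)
    · simp only [enorm_eq_nnnorm]
      gcongr
      exact tsub_le_self
    · refine tendsto_const_nhds.congr' ?_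
      obtain ⟨N, hN⟩ := exists_nat_ge ‖x‖₊
      filter_upwards [eventually_ge_atTop N] with n hn
      rw [tsub_eq_zero_of_le (hN.trans (by exact_mod_cast hn))]
      simp
  rw [lintegral_zero] at h
  have h2 := (ENNReal.continuous_rpow_const (y := (1 / 2 : ℝ))).tendsto 0 |>.comp h
  simpa [sqNorm, Function.comp_def] using h2

/-- Tails of a measure that is near a fixed one. -/
theorem SqNormNear.lintegral_tail_le {ν ρ : Measure E} {ε : ℝ≥0∞} (h : SqNormNear ε ν ρ) {r : ℝ≥0}
    (hr : sqNorm ρ (fun x => ‖x‖₊ - r) ≤ ε) :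
    ∫⁻ x in {x | ((2 * r : ℝ≥0) : ℝ≥0∞) < edist x 0}, edist x 0 ^ 2 ∂ν ≤ 16 * ε ^ 2 := by
  have hs : sqNorm ν (fun x => ‖x‖₊ - r) ≤ 2 * ε := by
    rw [two_mul]
    exact (h _ (lipschitzWith_nnnorm_sub r)).trans (by gcongr)
  calc ∫⁻ x in {x | ((2 * r : ℝ≥0) : ℝ≥0∞) < edist x 0}, edist x 0 ^ 2 ∂ν
      ≤ ∫⁻ x, 4 * ((‖x‖₊ - r : ℝ≥0) : ℝ≥0∞) ^ 2 ∂ν := by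
        rw [← lintegral_indicator (measurableSet_lt_edist _ _)]
        refine lintegral_mono fun x => ?_
        refine Set.indicator_le' (g := fun x => 4 * ((‖x‖₊ - r : ℝ≥0) : ℝ≥0∞) ^ 2) (fun x hx => ?_)
          (fun _ _ => zero_le) x
        simp only [Set.mem_ofPred_eq, edist_zero_right, enorm_eq_nnnorm, ENNReal.coe_lt_coe]
          at hx ⊢
        -- Beyond radius `2 * r`, removing `r` loses at most half of the norm.
        have hle : ‖x‖₊ ≤ 2 * (‖x‖₊ - r) := by
          rw [← NNReal.coe_le_coe, NNReal.coe_mul, NNReal.coe_sub]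
          · have : ((2 * r : ℝ≥0) : ℝ) < ‖x‖₊ := by exact_mod_cast hx
            push_cast at this ⊢
            linarith
          · exact le_trans (by rw [two_mul]; exact le_self_add) hx.le
        calc (‖x‖₊ : ℝ≥0∞) ^ 2 ≤ ((2 * (‖x‖₊ - r) : ℝ≥0) : ℝ≥0∞) ^ 2 := by gcongr
          _ = _ := by push_cast; ring
    _ = 4 * sqNorm ν (fun x => ‖x‖₊ - r) ^ 2 := by
        rw [lintegral_const_mul' _ _ (by simp), sqNorm_sq]
    _ ≤ 4 * (2 * ε) ^ 2 := by gcongr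
    _ = _ := by ring

/-- Mass far from a compact set, of a measure that is near a fixed one. -/
theorem SqNormNear.measure_compl_cthickening_le {ν ρ : Measure E} {δ s : ℝ≥0} (hδ : δ ≠ 0)
    (h : SqNormNear (δ * s / 2) ν ρ) {K : Set E} (hK : IsClosed K) (hne : K.Nonempty)
    (hρ : ρ Kᶜ ≤ (s / 2) ^ 2) :
    ν (Metric.cthickening δ K)ᶜ ≤ s ^ 2 := by
  -- A test function for Chebyshev's inequality: it vanishes on `K`, equals `δ` off the thickening,
  -- and is bounded by `δ`, so its `ρ`-norm only sees `ρ Kᶜ`.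
  let g : E → ℝ≥0 := fun x => min δ (Metric.infNndist x K)
  have hg : LipschitzWith 1 g := (Metric.lipschitz_infNndist_pt K).const_min δ
  have h1 : sqNorm ρ g ≤ δ * s / 2 := by
    rw [sqNorm, ENNReal.rpow_half_le_iff]
    calc ∫⁻ x, (g x : ℝ≥0∞) ^ 2 ∂ρ ≤ ∫⁻ x, Kᶜ.indicator (fun _ => (δ : ℝ≥0∞) ^ 2) x ∂ρ := by
          refine lintegral_mono fun x => ?_
          by_cases hx : x ∈ K
          · have : Metric.infNndist x K = 0 := by
              rw [← NNReal.coe_eq_zero, Metric.coe_infNndist, Metric.infDist_zero_of_mem hx]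
            simp [g, this]
          · rw [Set.indicator_of_mem (show x ∈ Kᶜ from hx)]
            gcongr
            exact min_le_left _ _
      _ = δ ^ 2 * ρ Kᶜ := lintegral_indicator_const hK.measurableSet.compl _
      _ ≤ δ ^ 2 * (s / 2) ^ 2 := by gcongr
      _ = _ := by rw [mul_div_assoc, mul_pow]
  have h2 : sqNorm ν g ≤ δ * s := by
    refine (h g hg).trans ?_
    calc _ ≤ (δ : ℝ≥0∞) * s / 2 + δ * s / 2 := by gcongr
      _ = _ := ENNReal.add_halves _
  have h3 : (δ : ℝ≥0∞) ^ 2 * ν (Metric.cthickening δ K)ᶜ ≤ δ ^ 2 * s ^ 2 := by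
    calc (δ : ℝ≥0∞) ^ 2 * ν (Metric.cthickening δ K)ᶜ
        = ∫⁻ x, (Metric.cthickening δ K)ᶜ.indicator (fun _ => (δ : ℝ≥0∞) ^ 2) x ∂ν :=
          (lintegral_indicator_const Metric.isClosed_cthickening.measurableSet.compl _).symm
      _ ≤ ∫⁻ x, (g x : ℝ≥0∞) ^ 2 ∂ν := by
          refine lintegral_mono fun x => ?_
          refine Set.indicator_le' (g := fun x => (g x : ℝ≥0∞) ^ 2) (fun x hx => ?_)
            (fun _ _ => zero_le) x
          have hx' : (δ : ℝ) < Metric.infDist x K := by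
            by_contra hcon
            refine hx (Metric.mem_cthickening_iff.2 ?_)
            exact (ENNReal.le_ofReal_iff_toReal_le (Metric.infEDist_ne_top hne) δ.2).2
              (not_lt.1 hcon)
          have : g x = δ := min_eq_left (by
            rw [← NNReal.coe_le_coe, Metric.coe_infNndist]; exact hx'.le)
          rw [this]
      _ = sqNorm ν g ^ 2 := (sqNorm_sq ν g).symm
      _ ≤ (δ * s) ^ 2 := by gcongr
      _ = _ := mul_pow _ _ _
  exact (ENNReal.mul_le_mul_iff_right (by simpa using hδ) (by simp)).1 h3

variable [TopologicalSpace.SeparableSpace E]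

/-- Under any coupling `g x ≤ g y + ‖x - y‖`; Minkowski's inequality in `L²(π)` splits the two
terms, and then one takes the infimum over `π`. -/
theorem sqNormNear_wassersteinTwo (ν ρ : Measure E) : SqNormNear (wassersteinTwo ν ρ) ν ρ := by
  intro g hg
  have hgm : Measurable fun x => (g x : ℝ≥0∞) := hg.continuous.measurable.coe_nnreal_ennreal
  rw [← tsub_le_iff_left]
  refine WassersteinSpace.le_wassersteinTwo fun π hπ => ?_
  obtain ⟨h0, h1, h2⟩ := hπ
  rw [tsub_le_iff_left]
  have hmink := ENNReal.lintegral_Lp_add_le (μ := π) (p := 2)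
    (hgm.comp measurable_snd).aemeasurable
    WassersteinSpace.measurable_cost.aemeasurable one_le_two
  simp only [Pi.add_apply, Function.comp_apply, ENNReal.rpow_two] at hmink
  calc sqNorm ν g = (∫⁻ z, (g z.1 : ℝ≥0∞) ^ 2 ∂π) ^ (1 / 2 : ℝ) := by
        rw [sqNorm, ← h1, Measure.fst, lintegral_map (hgm.pow_const 2) measurable_fst]
    _ ≤ (∫⁻ z, ((g z.2 : ℝ≥0∞) + ‖z.1 - z.2‖ₑ) ^ 2 ∂π) ^ (1 / 2 : ℝ) := by
        gcongr with z
        exact hg.coe_le_add_enorm _ _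
    _ ≤ _ := hmink
    _ = _ := by
        rw [sqNorm, ← h2, Measure.snd, lintegral_map (hgm.pow_const 2) measurable_snd]

variable [CompleteSpace E]

/-- A set of measures with finite nets for `SqNormNear` is tight and has uniformly integrable
second moments. -/
theorem isTight_and_unifSqIntegrable_of_finite_net {A : Set (Measure E)}
    (h : ∀ ε : ℝ≥0∞, ε ≠ 0 → ∃ F : Set (WassersteinSpace E), F.Finite ∧
      ∀ ν ∈ A, ∃ ρ ∈ F, SqNormNear ε ν ρ.toMeasure) :
    IsTightMeasureSet A ∧ UnifSqIntegrable 0 A := by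
  have : SecondCountableTopology E := UniformSpace.secondCountable_of_separable E
  constructor
  · refine isTightMeasureSet_of_cthickening fun δ hδ η hη => ?_
    lift δ to ℝ≥0 using hδ.le
    have hδ0 : δ ≠ 0 := by exact_mod_cast hδ.ne'
    obtain ⟨s, hs0, hsη⟩ : ∃ s : ℝ≥0, s ≠ 0 ∧ (s : ℝ≥0∞) ^ 2 ≤ η := by
      have hpos : (0 : ℝ≥0∞) < η ^ (1 / 2 : ℝ) :=
        ENNReal.rpow_pos_of_nonneg (pos_iff_ne_zero.2 hη) (by norm_num)
      obtain ⟨s, hs0, hs⟩ := ENNReal.lt_iff_exists_nnreal_btwn.1 hpos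
      refine ⟨s, by exact_mod_cast hs0.ne', ?_⟩
      calc (s : ℝ≥0∞) ^ 2 ≤ (η ^ (1 / 2 : ℝ)) ^ 2 := by gcongr
        _ = η := ENNReal.sq_rpow_half η
    obtain ⟨F, hF, hAF⟩ := h (δ * s / 2) (by simp [hδ0, hs0])
    have hsing : ∀ ρ : WassersteinSpace E, ∃ K : Set E, IsCompact K ∧
        ρ.toMeasure Kᶜ ≤ ((s : ℝ≥0∞) / 2) ^ 2 := fun ρ => by
      have ht := isTightMeasureSet_singleton (μ := ρ.toMeasure)
      rw [isTightMeasureSet_iff_exists_isCompact_measure_compl_le] at ht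
      obtain ⟨K, hK, hK'⟩ := ht (((s : ℝ≥0∞) / 2) ^ 2) (by
        rw [pos_iff_ne_zero]
        simp [hs0])
      exact ⟨K, hK, hK' _ rfl⟩
    choose K hKc hK using hsing
    -- The point `0` makes the set nonempty even when the net is empty, so that distances to it are
    -- finite.
    have hKF : IsCompact (insert 0 (⋃ ρ ∈ F, K ρ)) :=
      (hF.isCompact_biUnion fun ρ _ => hKc ρ).insert 0
    refine ⟨_, hKF, fun ν hν => ?_⟩
    obtain ⟨ρ, hρF, hρ⟩ := hAF ν hν
    refine (hρ.measure_compl_cthickening_le hδ0 hKF.isClosed (Set.insert_nonempty _ _) ?_).trans hsη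
    refine (measure_mono (Set.compl_subset_compl.2 ?_)).trans (hK ρ)
    exact (Set.subset_biUnion_of_mem (u := K) hρF).trans (Set.subset_insert _ _)
  · intro δ hδ
    -- Solves `16 * ε ^ 2 = δ`, matching the tail bound for nearby measures.
    set ε : ℝ≥0∞ := (δ / 16) ^ (1 / 2 : ℝ) with hε
    have hε0 : ε ≠ 0 := (ENNReal.rpow_pos_of_nonneg (pos_iff_ne_zero.2 (by simp [hδ]))
      (by norm_num)).ne'
    obtain ⟨F, hF, hAF⟩ := h ε hε0
    obtain ⟨n, hn⟩ := ((eventually_all_finite hF).2 fun ρ _ =>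
      ρ.tendsto_lintegral_tail.eventually (ge_mem_nhds (pos_iff_ne_zero.2 hε0))).exists
    refine ⟨2 * n, fun ν hν => ?_⟩
    obtain ⟨ρ, hρF, hρ⟩ := hAF ν hν
    refine (hρ.lintegral_tail_le (hn ρ hρF)).trans ?_
    rw [hε, ENNReal.sq_rpow_half, ENNReal.mul_div_cancel (by simp) (by simp)]

end SqNorm

/-! ### Compactness, completeness and separability of `𝒫₂(E)` -/

namespace WassersteinSpace

variable {E : Type*} [NormedAddCommGroup E] [MeasurableSpace E] [BorelSpace E]
  [TopologicalSpace.SeparableSpace E] [CompleteSpace E]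

theorem edist_eq (μ ν : WassersteinSpace E) :
    edist μ ν = wassersteinTwo μ.toMeasure ν.toMeasure := by
  rw [edist_dist]
  exact ENNReal.ofReal_toReal (cost_ne_top μ ν)

theorem edist_le_of_coupling {μ ν : WassersteinSpace E} {π : Measure (E × E)}
    (hπ : π ∈ couplings μ.toMeasure ν.toMeasure) {ε : ℝ≥0∞}
    (h : ∫⁻ z, edist z.1 z.2 ^ 2 ∂π ≤ ε ^ 2) : edist μ ν ≤ ε := by
  rw [edist_eq]
  refine (wassersteinTwo_le hπ).trans ?_
  rw [ENNReal.rpow_half_le_iff]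
  simpa only [edist_eq_enorm_sub] using h

theorem sqNormNear_edist (μ ν : WassersteinSpace E) :
    SqNormNear (edist μ ν) μ.toMeasure ν.toMeasure := by
  rw [edist_eq]
  exact sqNormNear_wassersteinTwo _ _

theorem isTight_and_unifSqIntegrable_of_totallyBounded {A : Set (WassersteinSpace E)}
    (hA : TotallyBounded A) :
    IsTightMeasureSet (toMeasure '' A) ∧ UnifSqIntegrable 0 (toMeasure '' A) := by
  refine isTight_and_unifSqIntegrable_of_finite_net fun ε hε => ?_
  obtain ⟨F, hF, hAF⟩ := Metric.totallyBounded_iff.1 hA (min ε 1).toReal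
    (ENNReal.toReal_pos (by simp [hε]) (by simp))
  refine ⟨F, hF, ?_⟩
  rintro _ ⟨ν, hν, rfl⟩
  obtain ⟨ρ, hρ, hνρ⟩ := Set.mem_iUnion₂.1 (hAF hν)
  refine ⟨ρ, hρ, (sqNormNear_edist ν ρ).mono ?_⟩
  rw [edist_dist]
  refine (ENNReal.ofReal_le_ofReal (Metric.mem_ball.1 hνρ).le).trans ?_
  rw [ENNReal.ofReal_toReal (by simp)]
  exact min_le_left _ _

/-- A point of `𝒫₂(E)` as a bundled probability measure. -/
def toProbabilityMeasure (μ : WassersteinSpace E) : ProbabilityMeasure E :=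
  ⟨μ.toMeasure, μ.isProbabilityMeasure⟩

/-- Compactness criterion in `𝒫₂(E)`. -/
theorem isCompact_closure_of_isTight {A : Set (WassersteinSpace E)}
    (ht : IsTightMeasureSet (toMeasure '' A)) (hU : UnifSqIntegrable 0 (toMeasure '' A)) :
    IsCompact (closure A) := by
  refine isCompact_closure_of_subseq fun u hu => ?_
  -- Prokhorov's theorem supplies a weak limit. Uniform integrability then puts it in `𝒫₂(E)` and
  -- makes the convergence hold for `W₂`.
  have hcomp : IsCompact (closure (toProbabilityMeasure '' A)) := by
    refine isCompact_closure_of_isTightMeasureSet (ht.subset ?_)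
    rintro _ ⟨_, ⟨μ, hμ, rfl⟩, rfl⟩
    exact ⟨μ, hμ, rfl⟩
  obtain ⟨μ, -, φ, hφ, hlim⟩ := hcomp.tendsto_subseq
    (x := fun n => (u n).toProbabilityMeasure) fun n => subset_closure ⟨_, hu n, rfl⟩
  have hUr : UnifSqIntegrable 0
      (Set.range fun n => (((u (φ n)).toProbabilityMeasure : ProbabilityMeasure E) : Measure E)) :=
    hU.mono (by rintro _ ⟨n, rfl⟩; exact ⟨_, hu _, rfl⟩)
  have hfin : ∫⁻ x, ‖x‖ₑ ^ 2 ∂(μ : Measure E) < ∞ := by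
    obtain ⟨R, hR⟩ := hUr 1 one_ne_zero
    have htail := lintegral_sq_edist_tail_le_of_tendsto hlim 0 (R := R) fun n => hR _ ⟨n, rfl⟩
    set s : Set E := {x | ((2 * R : ℝ≥0) : ℝ≥0∞) < edist x 0} with hs
    rw [← lintegral_add_compl _ (measurableSet_lt_edist (0 : E) (2 * R))]
    refine ENNReal.add_lt_top.2 ⟨?_, ?_⟩
    · simp only [edist_zero_right] at htail
      exact htail.trans_lt (by simp)
    · refine (setLIntegral_mono (g := fun _ => ((2 * R : ℝ≥0) : ℝ≥0∞) ^ 2) measurable_const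
        fun x hx => ?_).trans_lt ?_
      · have : edist x 0 ≤ ((2 * R : ℝ≥0) : ℝ≥0∞) := not_lt.1 hx
        rw [edist_zero_right] at this
        gcongr
      · rw [setLIntegral_const]
        exact ENNReal.mul_lt_top (by finiteness) (measure_lt_top _ _)
  let μ' : WassersteinSpace E := ⟨μ, inferInstance, hfin⟩
  refine ⟨μ', φ, hφ, ?_⟩
  rw [EMetric.tendsto_nhds]
  intro ε hε
  obtain ⟨e, he0, heε⟩ := exists_between hε
  filter_upwards [eventually_exists_coupling_cost_le hlim hUr (pow_ne_zero 2 he0.ne')]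
    with n ⟨π, hπ, hcost⟩
  rw [edist_comm]
  exact (edist_le_of_coupling (μ := μ') (ν := u (φ n)) hπ hcost).trans_lt heε

/-- A Cauchy sequence has totally bounded range, and the two halves of the compactness criterion
make that range relatively compact. Together with separability this makes `𝒫₂(E)` Polish, as
required for disintegrating couplings of laws on it. -/
instance instCompleteSpace : CompleteSpace (WassersteinSpace E) := by
  refine Metric.complete_of_cauchySeq_tendsto fun u hu => ?_
  obtain ⟨ht, hU⟩ := isTight_and_unifSqIntegrable_of_totallyBounded hu.totallyBounded_range
  obtain ⟨a, -, φ, hφ, ha⟩ := (isCompact_closure_of_isTight ht hU).tendsto_subseq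
    fun n => subset_closure (Set.mem_range_self n)
  exact ⟨a, tendsto_nhds_of_cauchySeq_of_subseq hu hφ.tendsto_atTop ha⟩

theorem isCompact_closure_of_support_finite {F : Set E} (hF : F.Finite) :
    IsCompact (closure {μ : WassersteinSpace E | μ.toMeasure Fᶜ = 0}) := by
  refine isCompact_closure_of_isTight ?_ ?_
  · rw [isTightMeasureSet_iff_exists_isCompact_measure_compl_le]
    refine fun ε _ => ⟨F, hF.isCompact, ?_⟩
    rintro _ ⟨μ, hμ, rfl⟩
    exact (le_of_eq hμ).trans zero_le
  · intro δ _
    obtain ⟨R, hR⟩ := (hF.image fun x => ‖x‖₊).bddAbove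
    refine ⟨R, ?_⟩
    rintro _ ⟨μ, hμ, rfl⟩
    refine le_of_eq_of_le (setLIntegral_measure_zero _ _ (measure_mono_null ?_ hμ)) zero_le
    intro x hx hxF
    have h1 : ‖x‖₊ ≤ R := hR ⟨x, hxF, rfl⟩
    have h2 : (R : ℝ≥0∞) < edist x 0 := hx
    rw [edist_zero_right, enorm_eq_nnnorm, ENNReal.coe_lt_coe] at h2
    exact absurd h1 (not_le.2 h2)

/-- Measures carried by finitely many fixed points form a relatively compact, hence separable, set,
so no rational weights are needed. Pushing `μ` forward by nearest-point maps onto a dense sequence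
shows that the union of these sets is dense. -/
instance instSeparableSpace : TopologicalSpace.SeparableSpace (WassersteinSpace E) := by
  -- Starting the sequence at `0` makes each nearest-point map move `x` by at most `‖x‖`, a
  -- square-integrable bound for dominated convergence.
  let e : ℕ → E := fun n => n.casesOn 0 (TopologicalSpace.denseSeq E)
  have he : ∀ x, x ∈ closure (Set.range e) := fun x => by
    refine closure_mono ?_ ((TopologicalSpace.denseRange_denseSeq E) x)
    rintro _ ⟨n, rfl⟩
    exact ⟨n + 1, rfl⟩
  let A : ℕ → Set (WassersteinSpace E) := fun N => {μ | μ.toMeasure (e '' Set.Iic N)ᶜ = 0}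
  have hsep : TopologicalSpace.IsSeparable (⋃ N, A N) := .iUnion fun N =>
    (isCompact_closure_of_support_finite ((Set.finite_Iic N).image e)).isSeparable.mono
      subset_closure
  rw [← TopologicalSpace.isSeparable_univ_iff]
  refine hsep.closure.mono fun μ _ => ?_
  let T : ℕ → E → E := fun N => SimpleFunc.nearestPt e N
  have hTm : ∀ N, Measurable (T N) := fun N => (SimpleFunc.nearestPt e N).measurable
  have hTle : ∀ N x, edist x (T N x) ≤ ‖x‖ₑ := fun N x => by
    have : edist (T N x) x ≤ edist 0 x := SimpleFunc.edist_nearestPt_le e x (Nat.zero_le N)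
    rwa [edist_zero_left, edist_comm] at this
  have hfin : ∀ N, ∫⁻ x, ‖x‖ₑ ^ 2 ∂(μ.toMeasure.map (T N)) < ∞ := fun N => by
    rw [lintegral_map (by fun_prop) (hTm N)]
    calc ∫⁻ x, ‖T N x‖ₑ ^ 2 ∂μ.toMeasure ≤ ∫⁻ x, 2 ^ 2 * ‖x‖ₑ ^ 2 ∂μ.toMeasure := by
          refine lintegral_mono fun x => ?_
          rw [← mul_pow]
          gcongr
          calc ‖T N x‖ₑ = edist (T N x) 0 := (edist_zero_right _).symm
            _ ≤ edist (T N x) x + edist x 0 := edist_triangle _ _ _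
            _ ≤ ‖x‖ₑ + ‖x‖ₑ := by
                rw [edist_zero_right, edist_comm]
                gcongr
                exact hTle N x
            _ = _ := (two_mul _).symm
      _ = 2 ^ 2 * ∫⁻ x, ‖x‖ₑ ^ 2 ∂μ.toMeasure := lintegral_const_mul' _ _ (by simp)
      _ < ∞ := ENNReal.mul_lt_top (by simp) μ.lintegral_lt_top
  let ν : ℕ → WassersteinSpace E := fun N =>
    ⟨μ.toMeasure.map (T N), Measure.isProbabilityMeasure_map (hTm N).aemeasurable, hfin N⟩
  have hνA : ∀ N, ν N ∈ A N := fun N => by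
    change (μ.toMeasure.map (T N)) _ = 0
    rw [Measure.map_apply (hTm N) ((Set.finite_Iic N).image e).measurableSet.compl]
    convert measure_empty (μ := μ.toMeasure)
    refine Set.eq_empty_of_forall_notMem fun x hx => hx ?_
    simp only [T, SimpleFunc.nearestPt, SimpleFunc.map_apply]
    exact ⟨_, SimpleFunc.nearestPtInd_le e N x, rfl⟩
  have hcost : Tendsto (fun N => ∫⁻ x, edist x (T N x) ^ 2 ∂μ.toMeasure) atTop
      (𝓝 (∫⁻ _, 0 ∂μ.toMeasure)) := by
    refine tendsto_lintegral_of_dominated_convergence (fun x => ‖x‖ₑ ^ 2) (fun N => ?_)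
      (fun N => Eventually.of_forall fun x => ?_) μ.lintegral_lt_top.ne
      (Eventually.of_forall fun x => ?_)
    · have : SecondCountableTopology E := UniformSpace.secondCountable_of_separable E
      exact (measurable_id.edist (hTm N)).pow_const 2
    · simp only
      gcongr
      exact hTle N x
    · have h1 := (tendsto_const_nhds (x := x)).edist
        (SimpleFunc.tendsto_nearestPt (e := e) (he x))
      rw [edist_self] at h1
      simpa using ENNReal.Tendsto.pow (n := 2) h1
  rw [lintegral_zero] at hcost
  refine mem_closure_of_tendsto (f := ν) (b := atTop) ?_
    (Eventually.of_forall fun N => Set.mem_iUnion.2 ⟨N, hνA N⟩)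
  rw [EMetric.tendsto_nhds]
  intro ε hε
  obtain ⟨d, hd0, hdε⟩ := exists_between hε
  filter_upwards [hcost.eventually (ge_mem_nhds (pos_iff_ne_zero.2 (pow_ne_zero 2 hd0.ne')))]
    with N hN
  rw [edist_comm]
  have : SecondCountableTopology E := UniformSpace.secondCountable_of_separable E
  have hm : Measurable fun x => (x, T N x) := measurable_id.prodMk (hTm N)
  refine (edist_le_of_coupling (π := μ.toMeasure.map fun x => (x, T N x))
    ⟨Measure.isProbabilityMeasure_map hm.aemeasurable, ?_, ?_⟩ ?_).trans_lt hdε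
  · rw [Measure.fst, Measure.map_map measurable_fst hm]
    exact Measure.map_id
  · rw [Measure.snd, Measure.map_map measurable_snd hm]
    rfl
  · rw [lintegral_map (by fun_prop) hm]
    exact hN

instance instSecondCountableTopology : SecondCountableTopology (WassersteinSpace E) :=
  UniformSpace.secondCountable_of_separable _

instance instNonempty : Nonempty (WassersteinSpace E) :=
  ⟨⟨Measure.dirac 0, inferInstance, by simp⟩⟩

end WassersteinSpace

/-! ### Realisation of couplings on one space -/

/-- Couplings with a common first marginal are realised on one probability space. -/
theorem exists_realisation_of_couplings {S : Type*} [MeasurableSpace S] [StandardBorelSpace S]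
    [Nonempty S] {L : Measure S} [IsProbabilityMeasure L] {Ls : ℕ → Measure S}
    {γ : ℕ → Measure (S × S)} (hγ : ∀ k, γ k ∈ couplings L (Ls k)) :
    ∃ (Ω' : Type w) (_ : MeasurableSpace Ω') (P' : Measure Ω') (Xs : ℕ → Ω' → S) (X : Ω' → S),
      IsProbabilityMeasure P' ∧ (∀ k, Measurable (Xs k)) ∧ Measurable X ∧
      ∀ k, P'.map (fun ω => (X ω, Xs k ω)) = γ k := by
  have hp : ∀ k, IsProbabilityMeasure (γ k) := fun k => (hγ k).1
  obtain ⟨g, hg, hgL⟩ := Measure.exists_measurable_map_eq L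
  choose f hf hfγ using fun k => Kernel.exists_measurable_map_eq_unitInterval (γ k).condKernel
  -- The first coordinate generates the shared variable; the second drives every conditional law
  -- given it. Only the pairs `(X, Xs k)` matter, so one source of randomness serves all `k`.
  let X : unitInterval × unitInterval → S := fun z => g z.1
  let Xs : ℕ → unitInterval × unitInterval → S := fun k z => f k (g z.1) z.2
  have hX : Measurable X := hg.comp measurable_fst
  have hXs : ∀ k, Measurable (Xs k) := fun k => (hf k).comp (hX.prodMk measurable_snd)
  have hlaw : ∀ k, (volume : Measure (unitInterval × unitInterval)).map
      (fun z => (X z, Xs k z)) = γ k := by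
    intro k
    refine Measure.ext_of_lintegral _ fun h hh => ?_
    have hm : Measurable fun z => (X z, Xs k z) := hX.prodMk (hXs k)
    have hslice : ∀ x, ∫⁻ v, h (x, f k x v) = ∫⁻ y, h (x, y) ∂(γ k).condKernel x := fun x => by
      rw [← hfγ k x, lintegral_map (by fun_prop) (hf k).of_uncurry_left]
    rw [lintegral_map hh hm, Measure.volume_eq_prod,
      lintegral_prod (fun z => h (X z, Xs k z)) (hh.comp hm).aemeasurable]
    simp only [X, Xs, hslice]
    conv_rhs => rw [← (γ k).disintegrate (γ k).condKernel, Measure.lintegral_compProd hh,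
      (hγ k).2.1, ← hgL]
    rw [lintegral_map _ hg]
    exact hh.lintegral_kernel_prod_right'
  -- Transports the construction to the prescribed universe.
  let e := (MeasurableEquiv.ulift.{0, w} (α := unitInterval × unitInterval))
  refine ⟨ULift.{w} (unitInterval × unitInterval), inferInstance,
    (volume : Measure (unitInterval × unitInterval)).map e.symm, fun k => Xs k ∘ e, X ∘ e,
    Measure.isProbabilityMeasure_map e.symm.measurable.aemeasurable,
    fun k => (hXs k).comp e.measurable, hX.comp e.measurable, fun k => ?_⟩
  rw [Measure.map_map ((hX.comp e.measurable).prodMk ((hXs k).comp e.measurable))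
    e.symm.measurable, ← hlaw k]
  rfl

/-! ### From intensities to laws of random measures -/

section RandomMeasure

theorem eLpNorm_dist_two {Ω X : Type*} [MeasurableSpace Ω] [PseudoMetricSpace X]
    (P : Measure Ω) (f g : Ω → X) :
    eLpNorm (fun ω => dist (f ω) (g ω)) 2 P =
      (∫⁻ ω, edist (f ω) (g ω) ^ 2 ∂P) ^ (1 / 2 : ℝ) := by
  rw [eLpNorm_eq_lintegral_rpow_enorm_toReal (by simp) (by simp)]
  simp only [ENNReal.toReal_ofNat, ENNReal.rpow_two]
  congr 2 with ω
  rw [Real.enorm_of_nonneg dist_nonneg, edist_dist]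

theorem unifSqIntegrable_range_iff {E : Type*} [NormedAddCommGroup E] [MeasurableSpace E]
    {ν : ℕ → Measure E} :
    UnifSqIntegrable 0 (Set.range ν) ↔
      Tendsto (fun R : ℝ => ⨆ N, ∫⁻ x in {x : E | R < ‖x‖}, ‖x‖ₑ ^ 2 ∂(ν N)) atTop (𝓝 0) := by
  have hset : ∀ R : ℝ≥0, {x : E | (R : ℝ≥0∞) < edist x 0} = {x | (R : ℝ) < ‖x‖} := fun R => by
    ext x
    simp only [Set.mem_ofPred_eq, edist_zero_right, enorm_eq_nnnorm, ENNReal.coe_lt_coe]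
    exact NNReal.coe_lt_coe.symm
  rw [ENNReal.tendsto_nhds_zero]
  constructor
  · intro h ε hε
    obtain ⟨R, hR⟩ := h ε hε.ne'
    filter_upwards [eventually_ge_atTop (R : ℝ)] with r hr
    refine iSup_le fun N => le_trans ?_ (hR _ ⟨N, rfl⟩)
    rw [hset]
    simp only [edist_zero_right]
    exact lintegral_mono_set fun x hx => hr.trans_lt hx
  · intro h δ hδ
    obtain ⟨R, hR, hR0⟩ := ((h δ (pos_iff_ne_zero.2 hδ)).and (eventually_ge_atTop 0)).exists
    lift R to ℝ≥0 using hR0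
    refine ⟨R, ?_⟩
    rintro _ ⟨N, rfl⟩
    rw [hset]
    simp only [edist_zero_right]
    exact (le_iSup (fun N => ∫⁻ x in {x : E | R < ‖x‖}, ‖x‖ₑ ^ 2 ∂(ν N)) N).trans hR

variable {E : Type*} [NormedAddCommGroup E] [MeasurableSpace E] [BorelSpace E]

/-- The part of the second moment of `ν` outside the ball of radius `R`. -/
noncomputable def sqTail (R : ℝ≥0) (ν : Measure E) : ℝ≥0∞ :=
  ∫⁻ x in {x : E | (R : ℝ≥0∞) < edist x 0}, edist x 0 ^ 2 ∂ν

theorem sqTail_eq_lintegral_indicator (R : ℝ≥0) (ν : Measure E) :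
    sqTail R ν = ∫⁻ x, {x : E | (R : ℝ≥0∞) < edist x 0}.indicator (fun x => edist x 0 ^ 2) x ∂ν :=
  (lintegral_indicator (measurableSet_lt_edist _ _) _).symm

theorem measurable_indicator_sqTail (R : ℝ≥0) :
    Measurable ({x : E | (R : ℝ≥0∞) < edist x 0}.indicator fun x => edist x 0 ^ 2) :=
  Measurable.indicator (by fun_prop) (measurableSet_lt_edist _ _)

theorem lintegral_sq_le_add_sqTail (R : ℝ≥0) (ν : Measure E) [IsProbabilityMeasure ν] :
    ∫⁻ x, edist x 0 ^ 2 ∂ν ≤ R ^ 2 + sqTail R ν := by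
  calc ∫⁻ x, edist x 0 ^ 2 ∂ν
      ≤ ∫⁻ x, ((R : ℝ≥0∞) ^ 2 +
          {x : E | (R : ℝ≥0∞) < edist x 0}.indicator (fun x => edist x 0 ^ 2) x) ∂ν := by
        refine lintegral_mono fun x => ?_
        by_cases hx : (R : ℝ≥0∞) < edist x 0
        · rw [Set.indicator_of_mem (show x ∈ {x : E | (R : ℝ≥0∞) < edist x 0} from hx)]
          exact le_add_self
        · exact le_add_right (by gcongr; exact not_lt.1 hx)
    _ = R ^ 2 + sqTail R ν := by
        rw [lintegral_add_left measurable_const, lintegral_const, measure_univ, mul_one,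
          sqTail_eq_lintegral_indicator]

variable [TopologicalSpace.SeparableSpace E] [CompleteSpace E]

theorem WassersteinSpace.measurable_sqTail (R : ℝ≥0) :
    Measurable fun μ : WassersteinSpace E => sqTail R μ.toMeasure := by
  simp only [sqTail_eq_lintegral_indicator]
  exact (Measure.measurable_lintegral (measurable_indicator_sqTail R)).comp
    WassersteinSpace.measurable_toMeasure

variable {Ω : Type*} [MeasurableSpace Ω] {P : Measure Ω}

theorem sqTail_intensity {μ : Ω → WassersteinSpace E} (hμ : Measurable μ) (R : ℝ≥0) :
    sqTail R (intensity P μ) = ∫⁻ ω, sqTail R (μ ω).toMeasure ∂P := by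
  simp only [sqTail_eq_lintegral_indicator]
  exact lintegral_intensity P hμ (measurable_indicator_sqTail R)

theorem intensity_apply {μ : Ω → WassersteinSpace E} (hμ : Measurable μ) {s : Set E}
    (hs : MeasurableSet s) : intensity P μ s = ∫⁻ ω, (μ ω).toMeasure s ∂P :=
  Measure.bind_apply hs (WassersteinSpace.measurable_toMeasure.comp hμ).aemeasurable

/-- The intensity only sees the law, so a Skorokhod representation leaves it unchanged. -/
theorem intensity_eq_of_map_eq {Ω' : Type*} [MeasurableSpace Ω'] {P' : Measure Ω'}
    {μ : Ω → WassersteinSpace E} {μ' : Ω' → WassersteinSpace E} (hμ : Measurable μ)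
    (hμ' : Measurable μ') (h : P'.map μ' = P.map μ) : intensity P' μ' = intensity P μ := by
  ext s hs
  have hm : Measurable fun m : WassersteinSpace E => m.toMeasure s :=
    (Measure.measurable_coe hs).comp WassersteinSpace.measurable_toMeasure
  rw [intensity_apply hμ hs, intensity_apply hμ' hs, ← lintegral_map hm hμ, ← lintegral_map hm hμ',
    h]

/-- Random measures that are close in `L²` have close intensities. -/
theorem sqNormNear_intensity {μ ν : Ω → WassersteinSpace E} (hμ : Measurable μ)
    (hν : Measurable ν) :
    SqNormNear ((∫⁻ ω, edist (μ ω) (ν ω) ^ 2 ∂P) ^ (1 / 2 : ℝ)) (intensity P μ)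
      (intensity P ν) := by
  intro g hg
  have hgm : Measurable fun x => (g x : ℝ≥0∞) ^ 2 :=
    hg.continuous.measurable.coe_nnreal_ennreal.pow_const 2
  -- The `L²` norm under the intensity is an iterated `L²` norm, so the comparison at each `ω`
  -- integrates by Minkowski's inequality in `L²(P)`.
  have hrep : ∀ {m : Ω → WassersteinSpace E}, Measurable m →
      sqNorm (intensity P m) g = (∫⁻ ω, sqNorm (m ω).toMeasure g ^ 2 ∂P) ^ (1 / 2 : ℝ) := by
    intro m hm
    simp only [sqNorm_sq]
    rw [sqNorm, lintegral_intensity P hm hgm]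
  have hgν : Measurable fun ω => sqNorm (ν ω).toMeasure g :=
    (((Measure.measurable_lintegral hgm).comp WassersteinSpace.measurable_toMeasure).comp
      hν).pow_const _
  have hmink := ENNReal.lintegral_Lp_add_le (μ := P) (p := 2) hgν.aemeasurable
    (hμ.edist hν).aemeasurable one_le_two
  simp only [Pi.add_apply, ENNReal.rpow_two] at hmink
  rw [hrep hμ, hrep hν]
  refine le_trans ?_ hmink
  gcongr with ω
  exact WassersteinSpace.sqNormNear_edist (μ ω) (ν ω) g hg

/-- The laws of random measures with tight and uniformly square integrable intensities are
tight. -/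
theorem isTightMeasureSet_laws {μ : ℕ → Ω → WassersteinSpace E} (hμ : ∀ N, Measurable (μ N))
    (ht : IsTightMeasureSet (Set.range fun N => intensity P (μ N)))
    (hU : UnifSqIntegrable 0 (Set.range fun N => intensity P (μ N))) :
    IsTightMeasureSet (Set.range fun N => P.map (μ N)) := by
  rw [isTightMeasureSet_iff_exists_isCompact_measure_compl_le] at ht ⊢
  intro ε hε
  obtain ⟨η, hη0, hη⟩ := ENNReal.exists_pos_sum_of_countable' hε.ne' ℕ
  let a : ℕ → ℝ≥0∞ := fun j => ((j : ℝ≥0∞) + 1)⁻¹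
  have ha0 : ∀ j, a j ≠ 0 := fun j => by simp [a]
  have hat : ∀ j, a j ≠ ∞ := fun j => by simp [a]
  have hhalf : ∀ j, η j * a j / 2 ≠ 0 := fun j => by simp [(hη0 j).ne', ha0 j]
  -- The product `η j * a j` is what Markov's inequality at threshold `a j` turns into probability
  -- `η j`; the halves are for lost mass and second-moment tail.
  choose K hKc hK using fun j => ht (η j * a j / 2) (pos_iff_ne_zero.2 (hhalf j))
  choose R hR using fun j => hU (η j * a j / 2) (hhalf j)
  let H : ℕ → WassersteinSpace E → ℝ≥0∞ := fun j m =>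
    m.toMeasure (K j)ᶜ + sqTail (R j) m.toMeasure
  have hm1 : ∀ j, Measurable fun m : WassersteinSpace E => m.toMeasure (K j)ᶜ := fun j =>
    (Measure.measurable_coe (hKc j).measurableSet.compl).comp WassersteinSpace.measurable_toMeasure
  have hHm : ∀ j, Measurable (H j) := fun j =>
    (hm1 j).add (WassersteinSpace.measurable_sqTail (R j))
  have hHint : ∀ j N, ∫⁻ ω, H j (μ N ω) ∂P ≤ η j * a j := fun j N => by
    have hm : Measurable fun ω => (μ N ω).toMeasure (K j)ᶜ := (hm1 j).comp (hμ N)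
    simp only [H]
    rw [lintegral_add_left hm, ← intensity_apply (hμ N) (hKc j).measurableSet.compl,
      ← sqTail_intensity (hμ N)]
    calc _ ≤ η j * a j / 2 + η j * a j / 2 := add_le_add (hK j _ ⟨N, rfl⟩) (hR j _ ⟨N, rfl⟩)
      _ = _ := ENNReal.add_halves _
  -- Since `a j → 0`, both parts of `H` are uniformly small on `A`, so `A` satisfies the compactness
  -- criterion.
  let A : Set (WassersteinSpace E) := {m | ∀ j, H j m ≤ a j}
  have hsmall : ∀ δ : ℝ≥0∞, 0 < δ → ∃ j, a j ≤ δ := fun δ hδ => by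
    obtain ⟨n, hn⟩ := ENNReal.exists_inv_nat_lt hδ.ne'
    exact ⟨n, (ENNReal.inv_le_inv.2 le_self_add).trans hn.le⟩
  have hA : IsCompact (closure A) := by
    refine WassersteinSpace.isCompact_closure_of_isTight ?_ fun δ hδ => ?_
    · rw [isTightMeasureSet_iff_exists_isCompact_measure_compl_le]
      intro δ hδ
      obtain ⟨j, hj⟩ := hsmall δ hδ
      refine ⟨K j, hKc j, ?_⟩
      rintro _ ⟨m, hm, rfl⟩
      exact (le_self_add.trans (hm j)).trans hj
    · obtain ⟨j, hj⟩ := hsmall δ (pos_iff_ne_zero.2 hδ)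
      refine ⟨R j, ?_⟩
      rintro _ ⟨m, hm, rfl⟩
      exact (le_add_self.trans (hm j)).trans hj
  refine ⟨closure A, hA, ?_⟩
  rintro _ ⟨N, rfl⟩
  rw [Measure.map_apply (hμ N) hA.measurableSet.compl]
  calc P (μ N ⁻¹' (closure A)ᶜ) ≤ P (⋃ j, {ω | a j ≤ H j (μ N ω)}) := by
        refine measure_mono fun ω hω => ?_
        have hω' : μ N ω ∉ A := fun h => hω (subset_closure h)
        simp only [A, Set.mem_ofPred_eq, not_forall, not_le] at hω'
        obtain ⟨j, hj⟩ := hω'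
        exact Set.mem_iUnion.2 ⟨j, hj.le⟩
    _ ≤ ∑' j, P {ω | a j ≤ H j (μ N ω)} := measure_iUnion_le _
    _ ≤ ∑' j, η j := by
        refine ENNReal.tsum_le_tsum fun j => ?_
        refine (meas_ge_le_lintegral_div ((hHm j).comp (hμ N)).aemeasurable (ha0 j)
          (hat j)).trans ?_
        exact ENNReal.div_le_of_le_mul (hHint j N)
    _ ≤ ε := hη.le

/-- The Dirac mass at the origin. -/
noncomputable def WassersteinSpace.diracZero : WassersteinSpace E :=
  ⟨Measure.dirac 0, inferInstance, by simp⟩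

theorem WassersteinSpace.sq_edist_diracZero_le (μ : WassersteinSpace E) :
    edist μ WassersteinSpace.diracZero ^ 2 ≤ ∫⁻ x, edist x 0 ^ 2 ∂μ.toMeasure := by
  have : SecondCountableTopology E := UniformSpace.secondCountable_of_separable E
  have hm : Measurable fun x : E => (x, (0 : E)) := by fun_prop
  have hle : edist μ WassersteinSpace.diracZero ≤
      (∫⁻ x, edist x 0 ^ 2 ∂μ.toMeasure) ^ (1 / 2 : ℝ) := by
    refine WassersteinSpace.edist_le_of_coupling (π := μ.toMeasure.map fun x => (x, (0 : E)))
      ⟨Measure.isProbabilityMeasure_map hm.aemeasurable, ?_, ?_⟩ ?_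
    · rw [Measure.fst, Measure.map_map measurable_fst hm]
      exact Measure.map_id
    · rw [Measure.snd, Measure.map_map measurable_snd hm]
      change μ.toMeasure.map (fun _ => (0 : E)) = Measure.dirac 0
      rw [Measure.map_const, measure_univ, one_smul]
    · rw [lintegral_map (by fun_prop) hm, ENNReal.sq_rpow_half]
  calc _ ≤ ((∫⁻ x, edist x 0 ^ 2 ∂μ.toMeasure) ^ (1 / 2 : ℝ)) ^ 2 := by gcongr
    _ = _ := ENNReal.sq_rpow_half _

/-- The laws of random measures with uniformly square integrable intensities are uniformly square
integrable. -/
theorem unifSqIntegrable_laws {μ : ℕ → Ω → WassersteinSpace E} (hμ : ∀ N, Measurable (μ N))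
    (hU : UnifSqIntegrable 0 (Set.range fun N => intensity P (μ N))) :
    UnifSqIntegrable WassersteinSpace.diracZero (Set.range fun N => P.map (μ N)) := by
  intro δ hδ
  obtain ⟨R, hR⟩ := hU (δ / 2) (by simp [hδ])
  refine ⟨2 * R, ?_⟩
  rintro _ ⟨N, rfl⟩
  calc ∫⁻ m in {m | ((2 * R : ℝ≥0) : ℝ≥0∞) < edist m WassersteinSpace.diracZero},
        edist m WassersteinSpace.diracZero ^ 2 ∂(P.map (μ N))
      ≤ ∫⁻ m, 2 * sqTail R m.toMeasure ∂(P.map (μ N)) := by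
        rw [← lintegral_indicator (measurableSet_lt_edist _ _)]
        refine lintegral_mono fun m => ?_
        refine Set.indicator_le' (g := fun m : WassersteinSpace E => 2 * sqTail R m.toMeasure)
          (fun m hm => ?_) (fun _ _ => zero_le) m
        have hd : edist m WassersteinSpace.diracZero ^ 2 ≤ R ^ 2 + sqTail R m.toMeasure :=
          m.sq_edist_diracZero_le.trans (lintegral_sq_le_add_sqTail R m.toMeasure)
        have hm' : 2 * (R : ℝ≥0∞) ^ 2 ≤ edist m WassersteinSpace.diracZero ^ 2 := by
          calc 2 * (R : ℝ≥0∞) ^ 2 ≤ 4 * (R : ℝ≥0∞) ^ 2 := by gcongr; norm_num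
            _ = ((2 * R : ℝ≥0) : ℝ≥0∞) ^ 2 := by push_cast; ring
            _ ≤ _ := by gcongr; exact le_of_lt hm
        -- With `W` the distance to the Dirac mass and `T` the tail, `W² ≤ R² + T` and `2R² ≤ W²`
        -- give `2W² ≤ W² + 2T`; the finite `W²` cancels.
        refine ENNReal.le_of_add_le_add_left
          (a := edist m WassersteinSpace.diracZero ^ 2) (by finiteness) ?_
        calc edist m WassersteinSpace.diracZero ^ 2 + edist m WassersteinSpace.diracZero ^ 2
            ≤ (R ^ 2 + sqTail R m.toMeasure) + (R ^ 2 + sqTail R m.toMeasure) := by gcongr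
          _ = 2 * R ^ 2 + 2 * sqTail R m.toMeasure := by ring
          _ ≤ _ := by gcongr
    _ = 2 * sqTail R (intensity P (μ N)) := by
        rw [lintegral_const_mul' _ _ (by simp),
          lintegral_map (WassersteinSpace.measurable_sqTail R) (hμ N), sqTail_intensity (hμ N)]
    _ ≤ 2 * (δ / 2) := by
        gcongr
        exact hR _ ⟨N, rfl⟩
    _ = δ := ENNReal.mul_div_cancel (by simp) (by simp)

variable [IsProbabilityMeasure P]

/-- Skorokhod representation, along a subsequence, of random measures whose intensities are tight
and uniformly square integrable. -/
theorem exists_representation_of_isTight {μ : ℕ → Ω → WassersteinSpace E}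
    (hμ : ∀ N, Measurable (μ N))
    (ht : IsTightMeasureSet (Set.range fun N => intensity P (μ N)))
    (hU : UnifSqIntegrable 0 (Set.range fun N => intensity P (μ N))) :
    ∃ ψ : ℕ → ℕ, StrictMono ψ ∧
      ∃ (Ω' : Type w) (_ : MeasurableSpace Ω') (P' : Measure Ω')
        (μ' : ℕ → Ω' → WassersteinSpace E) (μlim : Ω' → WassersteinSpace E),
        IsProbabilityMeasure P' ∧ (∀ k, Measurable (μ' k)) ∧ Measurable μlim ∧
        (∀ k, IdentDistrib (μ' k) (μ (ψ k)) P' P) ∧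
        (∀ᵐ ω ∂P', Tendsto (fun k => dist (μ' k ω) (μlim ω)) atTop (𝓝 0)) ∧
        (∀ k, MemLp (fun ω => dist (μ' k ω) (μlim ω)) 2 P') ∧
        Tendsto (fun k => eLpNorm (fun ω => dist (μ' k ω) (μlim ω)) 2 P') atTop (𝓝 0) := by
  let L : ℕ → ProbabilityMeasure (WassersteinSpace E) := fun N =>
    ⟨P.map (μ N), Measure.isProbabilityMeasure_map (hμ N).aemeasurable⟩
  have hcomp : IsCompact (closure (Set.range L)) := by
    refine isCompact_closure_of_isTightMeasureSet ((isTightMeasureSet_laws hμ ht hU).subset ?_)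
    rintro _ ⟨_, ⟨N, rfl⟩, rfl⟩
    exact ⟨N, rfl⟩
  obtain ⟨Linf, -, θ, hθ, hlim⟩ := hcomp.tendsto_subseq fun N => subset_closure (Set.mem_range_self N)
  have hUL : UnifSqIntegrable WassersteinSpace.diracZero
      (Set.range fun n => (((L ∘ θ) n : ProbabilityMeasure (WassersteinSpace E)) :
        Measure (WassersteinSpace E))) :=
    (unifSqIntegrable_laws hμ hU).mono (by rintro _ ⟨n, rfl⟩; exact ⟨θ n, rfl⟩)
  -- Geometric costs are summable, which turns `L²` convergence into almost sure convergence.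
  obtain ⟨χ, hχ, hγ⟩ := extraction_forall_of_eventually fun k : ℕ =>
    eventually_exists_coupling_cost_le hlim hUL (ε := 2⁻¹ ^ k) (by simp)
  choose γ hγmem hγcost using hγ
  obtain ⟨Ω', mΩ', P', μ', μlim, hP', hμ', hμlim, hlaw⟩ :=
    exists_realisation_of_couplings.{w} hγmem
  have hcost : ∀ k, ∫⁻ ω, edist (μ' k ω) (μlim ω) ^ 2 ∂P' ≤ 2⁻¹ ^ k := fun k => by
    have := hγcost k
    rw [← hlaw k, lintegral_map (by fun_prop) (hμlim.prodMk (hμ' k))] at this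
    simpa only [edist_comm] using this
  have hmd : ∀ k, Measurable fun ω => edist (μ' k ω) (μlim ω) ^ 2 := fun k =>
    ((hμ' k).edist hμlim).pow_const 2
  have hnorm : ∀ k, eLpNorm (fun ω => dist (μ' k ω) (μlim ω)) 2 P' ≤
      ((2⁻¹ : ℝ≥0∞) ^ k) ^ (1 / 2 : ℝ) := fun k => by
    rw [eLpNorm_dist_two]
    exact ENNReal.rpow_le_rpow (hcost k) (by norm_num)
  refine ⟨θ ∘ χ, hθ.comp hχ, Ω', mΩ', P', μ', μlim, hP', hμ', hμlim, fun k => ?_, ?_, fun k => ?_,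
    ?_⟩
  · refine ⟨(hμ' k).aemeasurable, (hμ _).aemeasurable, ?_⟩
    have h2 := (hγmem k).2.2
    rw [← hlaw k, Measure.snd, Measure.map_map measurable_snd (hμlim.prodMk (hμ' k))] at h2
    exact h2
  · have hsum : ∫⁻ ω, ∑' k, edist (μ' k ω) (μlim ω) ^ 2 ∂P' ≠ ∞ := by
      rw [lintegral_tsum fun k => (hmd k).aemeasurable]
      refine ne_top_of_le_ne_top ?_ (ENNReal.tsum_le_tsum hcost)
      rw [ENNReal.tsum_geometric]
      simp
    filter_upwards [ae_lt_top (Measurable.tsum hmd) hsum] with ω hω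
    have h0 := ENNReal.tendsto_atTop_zero_of_tsum_ne_top hω.ne
    have h1 := ((ENNReal.continuous_rpow_const (y := (1 / 2 : ℝ))).tendsto 0).comp h0
    simp only [Function.comp_def, ENNReal.rpow_half_sq] at h1
    rw [ENNReal.zero_rpow_of_pos (by norm_num)] at h1
    have h2 := (ENNReal.tendsto_toReal ENNReal.zero_ne_top).comp h1
    simpa only [Function.comp_def, edist_dist, ENNReal.toReal_ofReal dist_nonneg,
      ENNReal.toReal_zero] using h2
  · exact ⟨((hμ' k).dist hμlim).aestronglyMeasurable, (hnorm k).trans_lt (by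
      refine ENNReal.rpow_lt_top_of_nonneg (by norm_num) ?_
      finiteness)⟩
  · refine tendsto_of_tendsto_of_tendsto_of_le_of_le tendsto_const_nhds ?_ (fun _ => zero_le) hnorm
    have h1 := ((ENNReal.continuous_rpow_const (y := (1 / 2 : ℝ))).tendsto 0).comp
      (ENNReal.tendsto_pow_atTop_nhds_zero_of_lt_one (r := 2⁻¹) (by simp))
    rwa [ENNReal.zero_rpow_of_pos (by norm_num)] at h1

end RandomMeasure

/-! ### From representations back to compactness -/

/-- A sequence of intensities may repeat or permute indices, whereas (iii) concerns strictly
increasing ones. A nonincreasing subsequence of naturals is constant once it attains its minimum. -/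
theorem Nat.exists_subseq_strictMono_or_const (N : ℕ → ℕ) :
    ∃ g : ℕ → ℕ, StrictMono g ∧ (StrictMono (N ∘ g) ∨ ∃ c, ∀ n, N (g n) = c) := by
  obtain ⟨g, hg | hg⟩ := exists_increasing_or_nonincreasing_subseq (· < ·) N
  · exact ⟨g, g.strictMono, Or.inl fun m n hmn => hg m n hmn⟩
  · let m := Function.argmin (fun n => N (g n))
    have hm : ∀ n, N (g m) ≤ N (g n) := fun n => Function.argmin_le (fun n => N (g n)) n
    refine ⟨fun n => g (m + 1 + n), fun a b hab => g.strictMono (by omega), Or.inr ⟨N (g m), ?_⟩⟩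
    intro n
    exact le_antisymm (not_lt.1 (hg m (m + 1 + n) (by omega))) (hm _)

section Converse

variable {E : Type*} [NormedAddCommGroup E] [MeasurableSpace E] [BorelSpace E]
  [TopologicalSpace.SeparableSpace E] [CompleteSpace E]
  {Ω : Type*} [MeasurableSpace Ω] {P : Measure Ω} [IsProbabilityMeasure P]

/-- The intensities of an `L²`-convergent sequence of random measures form a relatively compact
set. -/
theorem isCompact_closure_intensities_of_tendsto {μ : ℕ → Ω → WassersteinSpace E}
    {μlim : Ω → WassersteinSpace E} (hμ : ∀ k, Measurable (μ k)) (hlim : Measurable μlim)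
    (hI : ∀ k, ∫⁻ x, ‖x‖ₑ ^ 2 ∂(intensity P (μ k)) < ∞)
    (hLp : ∀ k, MemLp (fun ω => dist (μ k ω) (μlim ω)) 2 P)
    (h : Tendsto (fun k => eLpNorm (fun ω => dist (μ k ω) (μlim ω)) 2 P) atTop (𝓝 0)) :
    IsCompact (closure (Set.range fun k => intensityPoint P (μ k) (hμ k) (hI k))) := by
  -- The limit is at finite `L²` distance from `μ 0`, and the norm is `1`-Lipschitz.
  have hIlim : ∫⁻ x, ‖x‖ₑ ^ 2 ∂(intensity P μlim) < ∞ := by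
    have hnear := sqNormNear_intensity (P := P) hlim (hμ 0) (fun x => ‖x‖₊) lipschitzWith_one_nnnorm
    simp only [edist_comm (μlim _)] at hnear
    rw [← eLpNorm_dist_two] at hnear
    have hfin : sqNorm (intensity P μlim) (fun x => ‖x‖₊) < ∞ :=
      hnear.trans_lt (ENNReal.add_lt_top.2
        ⟨ENNReal.rpow_lt_top_of_nonneg (by norm_num) (hI 0).ne, (hLp 0).2⟩)
    have := ENNReal.pow_lt_top (n := 2) hfin
    rwa [sqNorm_sq] at this
  have hnet : ∀ ε : ℝ≥0∞, ε ≠ 0 → ∃ F : Set (WassersteinSpace E), F.Finite ∧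
      ∀ ν ∈ WassersteinSpace.toMeasure ''
        (Set.range fun k => intensityPoint P (μ k) (hμ k) (hI k)),
        ∃ ρ ∈ F, SqNormNear ε ν ρ.toMeasure := by
    intro ε hε
    obtain ⟨k₀, hk₀⟩ := (h.eventually (ge_mem_nhds (pos_iff_ne_zero.2 hε))).exists_forall_of_atTop
    -- The limit intensity serves all late indices; each of the finitely many early ones is its own
    -- net point.
    refine ⟨insert (intensityPoint P μlim hlim hIlim)
      ((fun k => intensityPoint P (μ k) (hμ k) (hI k)) '' Set.Iio k₀),
      ((Set.finite_Iio k₀).image _).insert _, ?_⟩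
    rintro _ ⟨_, ⟨k, rfl⟩, rfl⟩
    rcases lt_or_ge k k₀ with hk | hk
    · exact ⟨_, Set.mem_insert_of_mem _ ⟨k, hk, rfl⟩, fun g _ => le_self_add⟩
    · refine ⟨_, Set.mem_insert _ _, (sqNormNear_intensity (hμ k) hlim).mono ?_⟩
      rw [← eLpNorm_dist_two]
      exact hk₀ k hk
  obtain ⟨ht, hU⟩ := isTight_and_unifSqIntegrable_of_finite_net hnet
  exact WassersteinSpace.isCompact_closure_of_isTight ht hU

end Converse

theorem mainTheorem6 {E : Type u} [NormedAddCommGroup E] [NormedSpace ℝ E]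
    [CompleteSpace E] [TopologicalSpace.SeparableSpace E] [MeasurableSpace E] [BorelSpace E]
    {Ω : Type v} [MeasurableSpace Ω] (P : Measure Ω) [IsProbabilityMeasure P]
    (μ : ℕ → Ω → WassersteinSpace E) (hμ : ∀ N, Measurable (μ N))
    (hI : ∀ N, ∫⁻ x, ‖x‖ₑ ^ 2 ∂(intensity P (μ N)) < ∞) :
    List.TFAE [
      -- (i) the intensities form a relatively compact subset of `𝒫₂(E)`
      IsCompact (closure (Set.range fun N => intensityPoint P (μ N) (hμ N) (hI N))),
      -- (ii) the intensities are tight, with uniformly integrable second moments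
      IsTightMeasureSet (Set.range fun N => intensity P (μ N)) ∧
        Tendsto (fun R : ℝ => ⨆ N, ∫⁻ x in {x : E | R < ‖x‖}, ‖x‖ₑ ^ 2 ∂(intensity P (μ N)))
          atTop (𝓝 0),
      -- (iii) every subsequence has a further subsequence with a Skorokhod representation
      ∀ φ : ℕ → ℕ, StrictMono φ → ∃ ψ : ℕ → ℕ, StrictMono ψ ∧
        ∃ (Ω' : Type w) (_ : MeasurableSpace Ω') (P' : Measure Ω')
          (μ' : ℕ → Ω' → WassersteinSpace E) (μlim : Ω' → WassersteinSpace E),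
          IsProbabilityMeasure P' ∧ (∀ k, Measurable (μ' k)) ∧ Measurable μlim ∧
          (∀ k, IdentDistrib (μ' k) (μ (φ (ψ k))) P' P) ∧
          (∀ᵐ ω ∂P', Tendsto (fun k => dist (μ' k ω) (μlim ω)) atTop (𝓝 0)) ∧
          (∀ k, MemLp (fun ω => dist (μ' k ω) (μlim ω)) 2 P') ∧
          Tendsto (fun k => eLpNorm (fun ω => dist (μ' k ω) (μlim ω)) 2 P') atTop (𝓝 0)] := by
  tfae_have 1 → 2 := by
    intro h
    obtain ⟨ht, hU⟩ := WassersteinSpace.isTight_and_unifSqIntegrable_of_totallyBounded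
      (h.totallyBounded.subset subset_closure)
    have hrange : WassersteinSpace.toMeasure ''
        (Set.range fun N => intensityPoint P (μ N) (hμ N) (hI N)) =
        Set.range fun N => intensity P (μ N) := by
      rw [← Set.range_comp]
      rfl
    rw [hrange] at ht hU
    exact ⟨ht, unifSqIntegrable_range_iff.1 hU⟩
  tfae_have 2 → 3 := by
    rintro ⟨ht, hU⟩ φ -
    have hsub : (Set.range fun N => intensity P (μ (φ N))) ⊆
        Set.range fun N => intensity P (μ N) := by
      rintro _ ⟨N, rfl⟩
      exact ⟨φ N, rfl⟩
    exact exists_representation_of_isTight (fun N => hμ (φ N)) (ht.subset hsub)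
      ((unifSqIntegrable_range_iff.2 hU).mono hsub)
  tfae_have 3 → 1 := by
    intro h
    refine isCompact_closure_of_subseq fun u hu => ?_
    choose N hN using hu
    obtain ⟨g, hg, hmono | ⟨c, hc⟩⟩ := Nat.exists_subseq_strictMono_or_const N
    · obtain ⟨ψ, hψ, Ω', mΩ', P', μ', μlim, hP', hμ', hlim, hid, -, hLp, hto⟩ := h _ hmono
      have hint : ∀ k, intensity P' (μ' k) = intensity P (μ (N (g (ψ k)))) := fun k =>
        intensity_eq_of_map_eq (hμ _) (hμ' k) (hid k).map_eq
      have hI' : ∀ k, ∫⁻ x, ‖x‖ₑ ^ 2 ∂(intensity P' (μ' k)) < ∞ := fun k => by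
        rw [hint k]
        exact hI _
      -- Compactness is obtained for the intensities on the new space, which coincide with the
      -- original ones by `hint`.
      obtain ⟨a, -, θ, hθ, ha⟩ := (isCompact_closure_intensities_of_tendsto hμ' hlim hI' hLp
        hto).tendsto_subseq fun k => subset_closure (Set.mem_range_self k)
      refine ⟨a, g ∘ ψ ∘ θ, hg.comp (hψ.comp hθ), ha.congr fun k => ?_⟩
      refine (WassersteinSpace.ext (hint (θ k))).trans (hN _)
    · refine ⟨intensityPoint P (μ c) (hμ c) (hI c), g, hg, tendsto_const_nhds.congr fun n => ?_⟩
      rw [Function.comp_apply, ← hN (g n), hc n]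
  tfae_finish
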